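/- Let $d\ge 1$, and let $M_{d\times d}(\mathbb R)$ be the space of real $d\times d$ matrices. Let $f:\mathbb R^d\to\mathbb R^d$ and $\sigma:\mathbb R^d\to M_{d\times d}(\mathbb R)$ satisfy the following. * (F1) $f$ is bounded and continuous. * (S1) $\sigma$ is twice continuously differentiable, and $\sigma$, $D\sigma$, $D^2\sigma$ are bounded. * (S2) There is $\lambda>0$ such that $|v^{\mathsf T}\sigma(x)v|\ge\lambda\|v\|^2$ for all $v,x\in\mathbb R^d$ (in particular every $\sigma(x)$ is invertible). * (S3) $\sigma^{-1}$ is conservative: for continuously differentiable curves $\gamma$ in $\mathbb R^d$, the path integral $\int_\gamma\sigma(x)^{-1}\,dx$ depends only on the end points of $\gamma$. Then there is a diffeomorphism $G:\mathbb R^d\to\mathbb R^d$ (a bijection such that $G$ and $G^{-1}$ are continuously differentiable) with $DG(z)=\sigma(z)^{-1}$ for all $z$, such that the function $\tilde f(z)=DG(G^{-1}(z))\,f(G^{-1}(z))$ is bounded and continuous, and such that the following holds. Let $\frac13<\alpha<H\le\frac12$ and $T>0$, and let $B^H$ be a $d$-dimensional fractional Brownian motion with Hurst parameter $H$ on a filtered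 probability space, that is, an adapted centered Gaussian process $(B^H_t)_{t\ge0}$ with covariance $\frac12\left(t^{2H}+s^{2H}-|t-s|^{2H}\right)I_d$. Then for almost every $\omega$, for every $\mathbb B$ such that $\mathbf B=(B^H(\omega),\mathbb B)$ is a geometric $\alpha$-rough path on $[0,T]$, for every $x\in\mathbb R^d$ and every path $X:[0,T]\to\mathbb R^d$, the following are equivalent: 1. $(X,\sigma(X))$ is a solution of the rough differential equation $$X_t=x+\int_0^t f(X_r)\,dr+\int_0^t\sigma(X_r)\,d\mathbf B_r,\qquad t\in[0,T];$$ 2. $Z_t=G(X_t)$ is continuous and satisfies $$Z_t=G(x)+\int_0^t\tilde f(Z_r)\,dr+B^H_t(\omega),\qquad t\in[0,T].$$ The notions used here are as follows. Write $W_{s,t}=W_t-W_s$. * $(W,\mathbb W)$ is a geometric $\alpha$-rough path on $[0,T]$ if $|W_{s,t}|\le C|t-s|^\alpha$ and $|\mathbb W_{s,t}|\le C|t-s|^{2\alpha}$ for some constant $C$, $\mathbb W_{s,t}-\mathbb W_{s,u}-\mathbb W_{u,t}=W_{s,u}\otimes W_{u,t}$, and $\mathrm{Sym}(\mathbb W_{s,t})=\frac12W_{s,t}\otimes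 W_{s,t}$, for all $s,u,t\in[0,T]$. * $(Y,Y')$ is a $W$-controlled rough path if $Y$ and $Y'$ are $\alpha$-Hölder on $[0,T]$ and $|Y_{s,t}-Y'_sW_{s,t}|\le C|t-s|^{2\alpha}$ for some constant $C$. * The rough integral $\int_0^tY_r\,d\mathbf W_r$ of $(Y,Y')$ is the limit of $\sum_{[u,v]\in\mathcal P}\left(Y_uW_{u,v}+Y'_u\mathbb W_{u,v}\right)$ over partitions $\mathcal P$ of $[0,t]$ as the mesh size tends to $0$. * A pair $(X,X')$ is a solution of the rough differential equation if it is a $B^H(\omega)$-controlled rough path, $X'=\sigma(X)$, and the equation holds with the last term the rough integral of the controlled rough path $(\sigma(X),D\sigma(X)X')$. -/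

import Mathlib

open MeasureTheory ProbabilityTheory Set
open scoped NNReal

namespace RoughSDE

/-- `ℝ^d` with the Euclidean norm. -/
abbrev Vec (d : ℕ) := EuclideanSpace ℝ (Fin d)

/-- Real `d × d` matrices, viewed as linear operators on `ℝ^d` (with the operator norm). -/
abbrev Mat (d : ℕ) := Vec d →L[ℝ] Vec d

/-- The standard basis vector `e_i` of `ℝ^d`. -/
noncomputable abbrev basisVec {d : ℕ} (i : Fin d) : Vec d := EuclideanSpace.single i (1 : ℝ)

/-! ### Assumptions on the coefficients -/

/-- A bounded continuous vector field on `ℝ^d`. -/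
def BoundedContinuous {d : ℕ} (f : Vec d → Vec d) : Prop :=
  Continuous f ∧ ∃ C : ℝ, ∀ x, ‖f x‖ ≤ C

/-- `σ` is twice continuously differentiable, and `σ`, `Dσ`, `D²σ` are bounded. -/
def BoundedC2 {d : ℕ} (σ : Vec d → Mat d) : Prop :=
  ContDiff ℝ 2 σ ∧
    ∃ C : ℝ, ∀ x, ‖σ x‖ ≤ C ∧ ‖fderiv ℝ σ x‖ ≤ C ∧ ‖iteratedFDeriv ℝ 2 σ x‖ ≤ C

/-- Uniform ellipticity: `|vᵀ σ(x) v| ≥ λ |v|²` for some `λ > 0`. -/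
def UniformlyElliptic {d : ℕ} (σ : Vec d → Mat d) : Prop :=
  ∃ lam : ℝ, 0 < lam ∧ ∀ v x : Vec d, lam * ‖v‖ ^ 2 ≤ |inner ℝ v (σ x v)|

/-- The matrix field `A` is conservative: the path integral `∫_γ A(x) dx` along a
continuously differentiable curve `γ` depends only on the end points of `γ`. -/
def Conservative {d : ℕ} (A : Vec d → Mat d) : Prop :=
  ∀ (a b : Vec d) (γ₁ γ₂ : Path a b),
    ContDiffOn ℝ 1 γ₁.extend (Icc 0 1) → ContDiffOn ℝ 1 γ₂.extend (Icc 0 1) →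
      curveIntegral A γ₁ = curveIntegral A γ₂

/-! ### Fractional Brownian motion -/

/-- `B` is a `d`-dimensional fractional Brownian motion with Hurst parameter `H`: an adapted
centered Gaussian process with covariance `½ (t^{2H} + s^{2H} - |t - s|^{2H}) I_d`. -/
structure IsFractionalBrownianMotion {Ω : Type*} [mΩ : MeasurableSpace Ω] {d : ℕ}
    (ℱ : Filtration ℝ≥0 mΩ) (B : ℝ≥0 → Ω → Vec d) (H : ℝ) (P : Measure Ω) : Prop where
  adapted : Adapted ℱ B
  gaussian : IsGaussianProcess B P
  centered : ∀ t, ∫ ω, B t ω ∂P = 0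
  covariance_eq : ∀ (s t : ℝ≥0) (i j : Fin d),
    covariance (fun ω => B s ω i) (fun ω => B t ω j) P =
      if i = j then
        ((t : ℝ) ^ (2 * H) + (s : ℝ) ^ (2 * H) - |(t : ℝ) - (s : ℝ)| ^ (2 * H)) / 2
      else 0

/-! ### Rough paths -/

/-- `(W, 𝕎)` is an `α`-rough path on `[0, T]`. The entry `𝕎 s t i j` stands for
`∫_s^t (W^i_r - W^i_s) dW^j_r`. Only the values at times in `[0, T]` matter. -/
structure IsRoughPath {d : ℕ} (α T : ℝ) (W : ℝ → Vec d)
    (𝕎 : ℝ → ℝ → Matrix (Fin d) (Fin d) ℝ) : Prop where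
  chen : ∀ s ∈ Icc 0 T, ∀ u ∈ Icc 0 T, ∀ t ∈ Icc 0 T, ∀ i j,
    𝕎 s t i j - 𝕎 s u i j - 𝕎 u t i j = (W u i - W s i) * (W t j - W u j)
  holder : ∃ C : ℝ, ∀ s ∈ Icc 0 T, ∀ t ∈ Icc 0 T, ‖W t - W s‖ ≤ C * |t - s| ^ α
  holder₂ : ∃ C : ℝ, ∀ s ∈ Icc 0 T, ∀ t ∈ Icc 0 T, ∀ i j,
    |𝕎 s t i j| ≤ C * |t - s| ^ (2 * α)

/-- A geometric rough path: moreover `Sym(𝕎_{s,t}) = ½ W_{s,t} ⊗ W_{s,t}`. -/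
structure IsGeometricRoughPath {d : ℕ} (α T : ℝ) (W : ℝ → Vec d)
    (𝕎 : ℝ → ℝ → Matrix (Fin d) (Fin d) ℝ) : Prop extends IsRoughPath α T W 𝕎 where
  sym : ∀ s ∈ Icc 0 T, ∀ t ∈ Icc 0 T, ∀ i j,
    (𝕎 s t i j + 𝕎 s t j i) / 2 = (W t i - W s i) * (W t j - W s j) / 2

/-- `(Y, Y')` is a `W`-controlled rough path on `[0, T]` with values in `F`; the Gubinelli
derivative `Y'_t` is a linear map `ℝ^d → F`. -/
structure IsControlled {d : ℕ} {F : Type*} [NormedAddCommGroup F] [NormedSpace ℝ F]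
    (α T : ℝ) (W : ℝ → Vec d) (Y : ℝ → F) (Y' : ℝ → Vec d →L[ℝ] F) : Prop where
  holder : ∃ C : ℝ, ∀ s ∈ Icc 0 T, ∀ t ∈ Icc 0 T, ‖Y t - Y s‖ ≤ C * |t - s| ^ α
  holder_deriv : ∃ C : ℝ, ∀ s ∈ Icc 0 T, ∀ t ∈ Icc 0 T, ‖Y' t - Y' s‖ ≤ C * |t - s| ^ α
  remainder : ∃ C : ℝ, ∀ s ∈ Icc 0 T, ∀ t ∈ Icc 0 T,
    ‖Y t - Y s - Y' s (W t - W s)‖ ≤ C * |t - s| ^ (2 * α)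

/-- The contraction of `y : ℝ^d → (ℝ^d → ℝ^d)` with a second order increment `w`:
`∑_{i,j} w^{i,j} y(e_i) e_j`. -/
noncomputable def contract {d : ℕ} (y : Vec d →L[ℝ] Mat d) (w : Matrix (Fin d) (Fin d) ℝ) :
    Vec d :=
  ∑ i, ∑ j, w i j • y (basisVec i) (basisVec j)

/-- `I` is the rough integral `∫_0^t (Y, Y') d(W, 𝕎)`: the limit of the sums
`∑ Y_u W_{u,v} + Y'_u 𝕎_{u,v}` over the intervals `[u, v]` of partitions
`0 = p 0 < p 1 < ⋯ < p n = t`, as the mesh size tends to zero. -/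
def HasRoughIntegral {d : ℕ} (W : ℝ → Vec d) (𝕎 : ℝ → ℝ → Matrix (Fin d) (Fin d) ℝ)
    (Y : ℝ → Mat d) (Y' : ℝ → Vec d →L[ℝ] Mat d) (t : ℝ) (I : Vec d) : Prop :=
  ∀ ε > 0, ∃ δ > 0, ∀ (n : ℕ) (p : ℕ → ℝ), p 0 = 0 → p n = t →
    (∀ k < n, p k < p (k + 1) ∧ p (k + 1) - p k < δ) →
      ‖(∑ k ∈ Finset.range n,
          (Y (p k) (W (p (k + 1)) - W (p k)) + contract (Y' (p k)) (𝕎 (p k) (p (k + 1))))) - I‖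
        < ε

/-! ### The two equations -/

/-- The controlled rough path `(X, X')` solves
`X_t = x₀ + ∫_0^t f(X_r) dr + ∫_0^t σ(X_r) d𝐖_r` on `[0, T]` : it is a fixed point of
`(Y, Y') ↦ (x₀ + ∫_0^· f(Y_r) dr + ∫_0^· σ(Y_r) d𝐖_r, σ(Y))`, where the last integral is the
rough integral of the controlled rough path `(σ(Y), Dσ(Y) Y')`. -/
structure IsRDESolution {d : ℕ} (α T : ℝ) (W : ℝ → Vec d)
    (𝕎 : ℝ → ℝ → Matrix (Fin d) (Fin d) ℝ) (f : Vec d → Vec d) (σ : Vec d → Mat d)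
    (x₀ : Vec d) (X : ℝ → Vec d) (X' : ℝ → Mat d) : Prop where
  controlled : IsControlled α T W X X'
  equation : ∀ t ∈ Icc 0 T,
    HasRoughIntegral W 𝕎 (fun r => σ (X r)) (fun r => (fderiv ℝ σ (X r)).comp (X' r)) t
      (X t - x₀ - ∫ r in (0 : ℝ)..t, f (X r))
  deriv_eq : ∀ t ∈ Icc 0 T, X' t = σ (X t)

/-- The continuous path `Z` solves `Z_t = z₀ + ∫_0^t g(Z_r) dr + W_t` on `[0, T]`. -/
structure IsAdditiveSolution {d : ℕ} (T : ℝ) (W : ℝ → Vec d) (g : Vec d → Vec d)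
    (z₀ : Vec d) (Z : ℝ → Vec d) : Prop where
  continuousOn : ContinuousOn Z (Icc 0 T)
  equation : ∀ t ∈ Icc 0 T, Z t = z₀ + (∫ r in (0 : ℝ)..t, g (Z r)) + W t

end RoughSDE

/-!
The flattening map `G` is a potential of `σ⁻¹`, and in the coordinates `Z = G(X)` the rough
equation loses its multiplicative noise. Instead of a rough Itô formula for `G`, the proof compares
one step of the two equations.

*The map `G`.* Path independence along smoothly stopped polygons gives additivity of the segment
integrals of `σ⁻¹` on triangles, hence a potential `G` (`Conservative.exists_hasFDerivAt`). By the
mean value theorem, `|⟨G x - G y, x - y⟩|` is a value of `|⟨w, σ⁻¹ w⟩|` at `w = x - y`, and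
ellipticity bounds this below by a multiple of `‖x - y‖²`. So `G` is antilipschitz; its range is
closed, and open by the inverse function theorem (`exists_isFlattening`).

*The common estimate.* The inverse `G⁻¹` has first derivative `σ ∘ G⁻¹` and second derivative `(Dσ
σ) ∘ G⁻¹`, and the latter is Lipschitz. In particular `Dσ(x) σ(x)` is a symmetric bilinear form, so
that against it the second level of a geometric rough path reduces to half the square of the first
level. A third order Taylor expansion of `G⁻¹` therefore shows that one step `∫ f̃(Z) dr + (W_t -
W_s)` of the additive equation, mapped back by `G⁻¹`, is the drift of `X` plus the germ `σ(X_s)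
W_{s,t} + Dσ(X_s) σ(X_s) 𝕎_{s,t}`, up to an error of order `|t - s|^{3α}`, where `3α > 1`
(`IsFlattening.exists_norm_euler_step_sub_le`).

*The equivalence.* If `Z` solves the additive equation, this step is the exact increment, so the
increments of `X` minus its drift agree with the germ up to order `3α`; the errors vanish in the
limit of Riemann sums, and the rough integral exists with the right value
(`isIndefiniteIntegral_of_norm_sub_le`). If `X` solves the rough equation, the sewing estimate
(`IsIndefiniteIntegral.norm_sub_le`) gives the same local comparison; since `G` is Lipschitz, the
difference of the two sides of the additive equation has increments of order `3α > 1` and is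
constant. Probability enters only through `B_0 = 0` almost surely.
-/

namespace RoughSDE

/-! ### A potential of the inverse coefficient -/

section Potential

variable {d : ℕ}

/-- The segment from `a` to `b`, run through with a smooth speed that vanishes to infinite order at
both end points, so that concatenations of such paths are again smooth. -/
noncomputable def smoothSegment (a b : Vec d) : Path a b where
  toFun t := a + Real.smoothTransition t • (b - a)
  continuous_toFun := by
    have : Continuous Real.smoothTransition := Real.smoothTransition.continuous
    fun_prop
  source' := by simp
  target' := by simp

lemma contDiffOn_extend_smoothSegment (a b : Vec d) :
    ContDiffOn ℝ 1 (smoothSegment a b).extend (Icc 0 1) := by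
  have h : ContDiff ℝ 1 fun t : ℝ => a + Real.smoothTransition t • (b - a) :=
    contDiff_const.add (Real.smoothTransition.contDiff.smul contDiff_const)
  refine h.contDiffOn.congr fun t ht => ?_
  rw [Path.extend_apply _ ht]
  rfl

lemma contDiffOn_extend_segment (a b : Vec d) :
    ContDiffOn ℝ 1 (Path.segment a b).extend (Icc 0 1) := by
  refine ContDiffOn.congr ?_ (Path.eqOn_extend_segment a b)
  have : ⇑(AffineMap.lineMap a b : ℝ →ᵃ[ℝ] Vec d) = fun t : ℝ => t • (b - a) + a :=
    funext (AffineMap.lineMap_apply_module' a b)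
  rw [this]
  fun_prop

lemma contDiffOn_extend_smoothSegment_trans (a b c : Vec d) :
    ContDiffOn ℝ 1 ((smoothSegment a b).trans (smoothSegment b c)).extend (Icc 0 1) := by
  have h : ContDiff ℝ 1 fun t : ℝ => a + Real.smoothTransition (2 * t) • (b - a) +
      Real.smoothTransition (2 * t - 1) • (c - b) := by
    refine (contDiff_const.add ((Real.smoothTransition.contDiff.comp ?_).smul contDiff_const)).add
      ((Real.smoothTransition.contDiff.comp ?_).smul contDiff_const) <;> fun_prop
  refine h.contDiffOn.congr fun t ht => ?_
  rw [Path.extend_apply _ ht, Path.trans_apply]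
  split_ifs with h2
  · have : Real.smoothTransition (2 * t - 1) = 0 :=
      Real.smoothTransition.zero_of_nonpos (by simp at h2; linarith)
    simp [smoothSegment, this]
  · have : Real.smoothTransition (2 * t) = 1 :=
      Real.smoothTransition.one_of_one_le (by simp at h2; linarith)
    simp [smoothSegment, this]

lemma Conservative.curveIntegral_segment_add {A : Vec d → Mat d} (hA : Conservative A)
    (hc : Continuous A) (a b c : Vec d) :
    curveIntegral A (.segment a c) =
      curveIntegral A (.segment a b) + curveIntegral A (.segment b c) := by
  have hi (a b : Vec d) : CurveIntegrable A (smoothSegment a b) :=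
    hc.continuousOn.curveIntegrable_of_contDiffOn (s := univ)
      (contDiffOn_extend_smoothSegment a b) (by simp)
  rw [hA a c _ ((smoothSegment a b).trans (smoothSegment b c)) (contDiffOn_extend_segment a c)
    (contDiffOn_extend_smoothSegment_trans a b c), curveIntegral_trans (hi a b) (hi b c),
    hA a b _ (smoothSegment a b) (contDiffOn_extend_segment a b)
      (contDiffOn_extend_smoothSegment a b),
    hA b c _ (smoothSegment b c) (contDiffOn_extend_segment b c)
      (contDiffOn_extend_smoothSegment b c)]

/-- A continuous conservative field is a derivative. -/
lemma Conservative.exists_hasFDerivAt {A : Vec d → Mat d} (hA : Conservative A)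
    (hc : Continuous A) : ∃ G : Vec d → Vec d, ∀ z, HasFDerivAt G (A z) z := by
  refine ⟨fun z => curveIntegral A (.segment 0 z), fun z => ?_⟩
  have h := (HasFDerivAt.curveIntegral_segment_source (a := z) hc).const_add
    (curveIntegral A (.segment 0 z))
  refine h.congr_of_eventuallyEq (.of_forall fun y => ?_)
  exact hA.curveIntegral_segment_add hc 0 z y

end Potential

/-! ### The inverse coefficient and the flattening diffeomorphism -/

section Flattening

variable {d : ℕ} {σ : Vec d → Mat d}

lemma mul_norm_le_norm_apply {lam : ℝ} (h : ∀ v x : Vec d, lam * ‖v‖ ^ 2 ≤ |inner ℝ v (σ x v)|)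
    (x v : Vec d) : lam * ‖v‖ ≤ ‖σ x v‖ := by
  rcases eq_or_ne v 0 with rfl | hv
  · simp
  · have h1 := (h v x).trans (abs_real_inner_le_norm v (σ x v))
    have : 0 < ‖v‖ := norm_pos_iff.2 hv
    nlinarith

/-- An elliptic coefficient takes invertible values. -/
lemma exists_equiv_of_elliptic {lam : ℝ} (hlam : 0 < lam)
    (h : ∀ v x : Vec d, lam * ‖v‖ ^ 2 ≤ |inner ℝ v (σ x v)|) (x : Vec d) :
    ∃ e : Vec d ≃L[ℝ] Vec d, (e : Vec d →L[ℝ] Vec d) = σ x := by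
  have hinj : Function.Injective (σ x : Vec d →ₗ[ℝ] Vec d) := by
    rw [← LinearMap.ker_eq_bot, LinearMap.ker_eq_bot']
    intro v hv
    have h1 := mul_norm_le_norm_apply h x v
    have hv' : σ x v = 0 := hv
    rw [hv', norm_zero] at h1
    exact norm_le_zero_iff.1 (nonpos_of_mul_nonpos_right h1 hlam)
  refine ⟨(LinearEquiv.ofInjectiveEndo _ hinj).toContinuousLinearEquiv, ?_⟩
  ext1 v
  rfl

lemma continuous_inverse_of_elliptic (hσ : Continuous σ) {lam : ℝ} (hlam : 0 < lam)
    (h : ∀ v x : Vec d, lam * ‖v‖ ^ 2 ≤ |inner ℝ v (σ x v)|) :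
    Continuous fun x => (σ x).inverse := by
  rw [continuous_iff_continuousAt]
  intro x
  obtain ⟨e, he⟩ := exists_equiv_of_elliptic hlam h x
  have h1 : ContDiffAt ℝ 0 ContinuousLinearMap.inverse (σ x) := he ▸ contDiffAt_map_inverse e
  exact h1.continuousAt.comp hσ.continuousAt

lemma apply_inverse_of_elliptic {lam : ℝ} (hlam : 0 < lam)
    (h : ∀ v x : Vec d, lam * ‖v‖ ^ 2 ≤ |inner ℝ v (σ x v)|) (x v : Vec d) :
    σ x ((σ x).inverse v) = v := by
  obtain ⟨e, he⟩ := exists_equiv_of_elliptic hlam h x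
  simp [← he]

lemma norm_inverse_le_of_elliptic {lam : ℝ} (hlam : 0 < lam)
    (h : ∀ v x : Vec d, lam * ‖v‖ ^ 2 ≤ |inner ℝ v (σ x v)|) (x : Vec d) :
    ‖(σ x).inverse‖ ≤ lam⁻¹ := by
  refine ContinuousLinearMap.opNorm_le_bound _ (by positivity) fun v => ?_
  have h1 := mul_norm_le_norm_apply h x ((σ x).inverse v)
  rw [apply_inverse_of_elliptic hlam h] at h1
  rw [inv_mul_eq_div, le_div_iff₀ hlam]
  linarith

/-- Along the segment from `y` to `x`, the function `⟨G, x - y⟩` has derivative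
`⟨x - y, σ⁻¹ (x - y)⟩`, which ellipticity keeps away from zero; by the mean value theorem no sign of
this quadratic form has to be singled out. -/
lemma antilipschitz_of_elliptic {lam K : ℝ} (hlam : 0 < lam) (hK : 0 < K)
    (h : ∀ v x : Vec d, lam * ‖v‖ ^ 2 ≤ |inner ℝ v (σ x v)|) (hσ : ∀ x, ‖σ x‖ ≤ K)
    {G : Vec d → Vec d} (hG : ∀ z, HasFDerivAt G (σ z).inverse z) (x y : Vec d) :
    ‖x - y‖ ≤ K ^ 2 / lam * ‖G x - G y‖ := by
  set w := x - y with hw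
  have hd (t : ℝ) : HasDerivAt (fun t : ℝ => inner ℝ w (G (y + t • w)))
      (inner ℝ w ((σ (y + t • w)).inverse w)) t := by
    have h1 : HasDerivAt (fun t : ℝ => y + t • w) w t := by
      simpa using ((hasDerivAt_id t).smul_const w).const_add y
    have h2 := (hG (y + t • w)).comp_hasDerivAt t h1
    simpa using (hasDerivAt_const t w).inner ℝ h2
  obtain ⟨t, -, ht⟩ := exists_hasDerivAt_eq_slope (fun t : ℝ => inner ℝ w (G (y + t • w)))
    (fun t => inner ℝ w ((σ (y + t • w)).inverse w)) zero_lt_one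
    (fun t _ => (hd t).continuousAt.continuousWithinAt) (fun t _ => hd t)
  set u := (σ (y + t • w)).inverse w with hu
  have hσu : σ (y + t • w) u = w := apply_inverse_of_elliptic hlam h _ _
  have hxy : y + w = x := by simp [hw]
  simp only [one_smul, zero_smul, add_zero, sub_zero, div_one, hxy, ← inner_sub_right] at ht
  have h1 := h u (y + t • w)
  rw [hσu, real_inner_comm, ht] at h1
  have h2 : ‖w‖ ≤ K * ‖u‖ := by
    have := (σ (y + t • w)).le_of_opNorm_le (hσ _) u
    rwa [hσu] at this
  have h3 := h1.trans (abs_real_inner_le_norm w (G x - G y))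
  rcases (norm_nonneg w).eq_or_lt with h0 | h0
  · rw [← h0]; positivity
  · rw [div_mul_eq_mul_div, le_div_iff₀ hlam]
    have h4 : ‖w‖ ^ 2 ≤ K ^ 2 * ‖u‖ ^ 2 := by
      rw [← mul_pow]; exact pow_le_pow_left₀ h0.le h2 2
    have h5 : lam * ‖w‖ ^ 2 ≤ K ^ 2 * (‖w‖ * ‖G x - G y‖) := by
      nlinarith [mul_le_mul_of_nonneg_left h3 (sq_nonneg K), mul_le_mul_of_nonneg_left h4 hlam.le]
    refine le_of_mul_le_mul_left ?_ h0
    nlinarith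

/-- The diffeomorphism `G` has derivative `σ⁻¹`, and `K` bounds the quantities that enter the
estimates: `σ`, `σ⁻¹`, `Dσ` and the Lipschitz constant of `Dσ`. -/
structure IsFlattening (σ : Vec d → Mat d) (G : Vec d ≃ Vec d) (K : ℝ) : Prop where
  nonneg : 0 ≤ K
  differentiable : Differentiable ℝ σ
  norm_le : ∀ x, ‖σ x‖ ≤ K
  norm_fderiv_le : ∀ x, ‖fderiv ℝ σ x‖ ≤ K
  norm_fderiv_sub_le : ∀ x y, ‖fderiv ℝ σ x - fderiv ℝ σ y‖ ≤ K * ‖x - y‖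
  continuous_inverse : Continuous fun x => (σ x).inverse
  norm_inverse_le : ∀ x, ‖(σ x).inverse‖ ≤ K
  apply_inverse : ∀ x v, σ x ((σ x).inverse v) = v
  hasFDerivAt : ∀ x, HasFDerivAt G (σ x).inverse x
  hasFDerivAt_symm : ∀ z, HasFDerivAt G.symm (σ (G.symm z)) z

lemma norm_fderiv_sub_le_of_norm_iteratedFDeriv_le {C : ℝ} (hσ : ContDiff ℝ 2 σ)
    (hC : ∀ x, ‖iteratedFDeriv ℝ 2 σ x‖ ≤ C) (x y : Vec d) :
    ‖fderiv ℝ σ x - fderiv ℝ σ y‖ ≤ C * ‖x - y‖ := by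
  have h1 : Differentiable ℝ (fderiv ℝ σ) :=
    (hσ.fderiv_right (m := 1) (by norm_num)).differentiable (by norm_num)
  refine convex_univ.norm_image_sub_le_of_norm_hasFDerivWithin_le
    (f' := fderiv ℝ (fderiv ℝ σ)) (fun z _ => (h1 z).hasFDerivAt.hasFDerivWithinAt)
    (fun z _ => ?_) (mem_univ y) (mem_univ x)
  rw [← norm_iteratedFDeriv_one, norm_iteratedFDeriv_fderiv]
  exact hC z

/-- Existence of the flattening diffeomorphism. The potential of `σ⁻¹` is an open map by the inverse
function theorem and has closed range by the antilipschitz bound, so it is onto. -/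
theorem exists_isFlattening (hS1 : BoundedC2 σ) (hS2 : UniformlyElliptic σ)
    (hS3 : Conservative fun x => (σ x).inverse) :
    ∃ (G : Vec d ≃ Vec d) (K : ℝ), IsFlattening σ G K := by
  obtain ⟨hσ, C, hC⟩ := hS1
  obtain ⟨lam, hlam, h⟩ := hS2
  have hcont := continuous_inverse_of_elliptic hσ.continuous hlam h
  obtain ⟨G, hG⟩ := hS3.exists_hasFDerivAt hcont
  have hanti : AntilipschitzWith (Real.toNNReal ((max C 1) ^ 2 / lam)) G := by
    refine AntilipschitzWith.of_le_mul_dist fun x y => ?_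
    rw [Real.coe_toNNReal _ (by positivity), dist_eq_norm, dist_eq_norm]
    exact antilipschitz_of_elliptic hlam (by positivity) h
      (fun x => (hC x).1.trans (le_max_left _ _)) hG x y
  have hlip : LipschitzWith (Real.toNNReal lam⁻¹) G := by
    refine lipschitzWith_of_nnnorm_fderiv_le (𝕜 := ℝ) (fun z => (hG z).differentiableAt) fun z => ?_
    rw [(hG z).fderiv, ← NNReal.coe_le_coe, Real.coe_toNNReal _ (by positivity)]
    exact norm_inverse_le_of_elliptic hlam h z
  choose e he using exists_equiv_of_elliptic hlam h
  have heG (z : Vec d) : HasFDerivAt G ((e z).symm : Vec d →L[ℝ] Vec d) z := by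
    simpa [← he] using hG z
  have hopen : IsOpenMap G := by
    refine isOpenMap_of_hasStrictFDerivAt_equiv (𝕜 := ℝ) (f' := fun z => (e z).symm) fun z => ?_
    refine hasStrictFDerivAt_of_hasFDerivAt_of_continuousAt (.of_forall heG) ?_
    have : (fun z => ((e z).symm : Vec d →L[ℝ] Vec d)) = fun z => (σ z).inverse := by
      ext1 z; simp [← he]
    exact this ▸ hcont.continuousAt
  have hsurj : Function.Surjective G := by
    rw [← range_eq_univ]
    exact IsClopen.eq_univ ⟨hanti.isClosed_range hlip.uniformContinuous, hopen.isOpen_range⟩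
      (range_nonempty G)
  let E := Equiv.ofBijective G ⟨hanti.injective, hsurj⟩
  have hsymm : Continuous E.symm :=
    (E.toHomeomorphOfContinuousOpen hlip.continuous hopen).symm.continuous
  refine ⟨E, max C lam⁻¹, ⟨le_max_of_le_right (by positivity), hσ.differentiable (by norm_num),
    fun x => (hC x).1.trans (le_max_left _ _), fun x => (hC x).2.1.trans (le_max_left _ _),
    norm_fderiv_sub_le_of_norm_iteratedFDeriv_le hσ fun x => (hC x).2.2.trans (le_max_left _ _),
    hcont, fun x => (norm_inverse_le_of_elliptic hlam h x).trans (le_max_right _ _),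
    apply_inverse_of_elliptic hlam h, hG, fun z => ?_⟩⟩
  rw [← he]
  exact (heG (E.symm z)).of_local_left_inverse hsymm.continuousAt
    (.of_forall E.apply_symm_apply)

end Flattening

/-! ### Second and third order Taylor estimates -/

section Taylor

variable {E F : Type*} [NormedAddCommGroup E] [NormedSpace ℝ E] [NormedAddCommGroup F]
  [NormedSpace ℝ F]

lemma norm_sub_le_of_hasFDerivAt_ball {f : E → F} {f' : E → E →L[ℝ] F}
    (hf : ∀ z, HasFDerivAt f (f' z) z) {z h : E} {φ : E →L[ℝ] F} {C : ℝ}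
    (hC : ∀ y, ‖y - z‖ ≤ ‖h‖ → ‖f' y - φ‖ ≤ C) : ‖f (z + h) - f z - φ h‖ ≤ C * ‖h‖ := by
  have := (convex_closedBall z ‖h‖).norm_image_sub_le_of_norm_hasFDerivWithin_le' (x := z)
    (y := z + h) (φ := φ) (fun y _ => (hf y).hasFDerivWithinAt)
    (fun y hy => hC y (by simpa [dist_eq_norm] using hy)) (by simp) (by simp)
  simpa using this

lemma norm_taylor_one_le {f : E → F} {f' : E → E →L[ℝ] F} {L : ℝ}
    (hf : ∀ z, HasFDerivAt f (f' z) z) (hL : ∀ x y, ‖f' x - f' y‖ ≤ L * ‖x - y‖) (hL0 : 0 ≤ L)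
    (z h : E) : ‖f (z + h) - f z - f' z h‖ ≤ L * ‖h‖ ^ 2 := by
  refine (norm_sub_le_of_hasFDerivAt_ball hf (C := L * ‖h‖) fun y hy => ?_).trans_eq (by ring)
  exact (hL y z).trans (by gcongr)

lemma norm_taylor_two_le {f : E → F} {f' : E → E →L[ℝ] F} {f'' : E → E →L[ℝ] E →L[ℝ] F} {L : ℝ}
    (hf : ∀ z, HasFDerivAt f (f' z) z) (hf' : ∀ z, HasFDerivAt f' (f'' z) z)
    (hL : ∀ x y, ‖f'' x - f'' y‖ ≤ L * ‖x - y‖) (hL0 : 0 ≤ L) (z h : E) :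
    ‖f (z + h) - f z - f' z h - (2⁻¹ : ℝ) • f'' z h h‖ ≤ L * ‖h‖ ^ 3 := by
  have hsymm (u v : E) : f'' z u v = f'' z v u :=
    second_derivative_symmetric (𝕜 := ℝ) hf (hf' z) u v
  -- Subtracting the quadratic term reduces the claim to the mean value inequality.
  have hg (y : E) : HasFDerivAt (fun y => f y - (2⁻¹ : ℝ) • f'' z (y - z) (y - z))
      (f' y - f'' z (y - z)) y := by
    have h1 : HasFDerivAt (fun y : E => y - z) (ContinuousLinearMap.id ℝ E) y :=
      (hasFDerivAt_id y).sub_const z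
    have h2 := ((((f'' z).hasFDerivAt.comp y h1).clm_apply h1).const_smul (2⁻¹ : ℝ))
    refine ((hf y).sub h2).congr_fderiv ?_
    ext v
    simp [hsymm v y, hsymm v z]
    module
  have h1 := norm_sub_le_of_hasFDerivAt_ball hg (z := z) (h := h) (φ := f' z) (C := L * ‖h‖ ^ 2)
    fun y hy => by
      have h2 := norm_taylor_one_le hf' hL hL0 z (y - z)
      rw [add_sub_cancel] at h2
      rw [sub_right_comm]
      refine h2.trans ?_
      gcongr
  calc _ = _ := by
        congr 1
        simp
        abel
    _ ≤ _ := h1.trans_eq (by ring)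

/-- The Taylor expansion of order three in the direction `w + v`, where `v` is of second order. -/
lemma norm_taylor_two_add_le {f : E → F} {f' : E → E →L[ℝ] F} {f'' : E → E →L[ℝ] E →L[ℝ] F}
    {L K : ℝ} (hf : ∀ z, HasFDerivAt f (f' z) z) (hf' : ∀ z, HasFDerivAt f' (f'' z) z)
    (hL : ∀ x y, ‖f'' x - f'' y‖ ≤ L * ‖x - y‖) (hL0 : 0 ≤ L) (hK : ∀ x, ‖f'' x‖ ≤ K)
    (z w v : E) :
    ‖f (z + (v + w)) - f z - f' z v - (f' z w + (2⁻¹ : ℝ) • f'' z w w)‖ ≤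
      L * (‖v‖ + ‖w‖) ^ 3 + K * (‖v‖ * ‖w‖ + ‖v‖ ^ 2) := by
  have hK0 : 0 ≤ K := (norm_nonneg (f'' z)).trans (hK z)
  have hsymm : f'' z v w = f'' z w v := second_derivative_symmetric (𝕜 := ℝ) hf (hf' z) v w
  have h1 := (norm_taylor_two_le hf hf' hL hL0 z (v + w)).trans
    (mul_le_mul_of_nonneg_left (pow_le_pow_left₀ (norm_nonneg _) (norm_add_le v w) 3) hL0)
  have hb (a b : E) : ‖f'' z a b‖ ≤ K * ‖a‖ * ‖b‖ :=
    ((f'' z).le_opNorm₂ a b).trans (by gcongr; exact hK z)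
  have h2 : ‖(2⁻¹ : ℝ) • f'' z v v‖ ≤ K * ‖v‖ ^ 2 := by
    rw [norm_smul]
    have := hb v v
    have h3 : ‖(2⁻¹ : ℝ)‖ ≤ 1 := by norm_num
    nlinarith [mul_le_mul_of_nonneg_right h3 (norm_nonneg (f'' z v v))]
  have h3 := hb v w
  calc _ = ‖(f (z + (v + w)) - f z - f' z (v + w) - (2⁻¹ : ℝ) • f'' z (v + w) (v + w)) +
        (f'' z v w + (2⁻¹ : ℝ) • f'' z v v)‖ := by
        congr 1
        simp only [map_add, add_apply, ← hsymm]
        module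
    _ ≤ _ := (norm_add_le _ _).trans (add_le_add h1 (norm_add_le _ _))
    _ ≤ _ := by linarith

end Taylor

/-! ### Riemann sums of two-parameter functions -/

section Sewing

variable {E : Type*} [NormedAddCommGroup E]

/-- `J` is the indefinite integral of the germ `Ξ` on `[0, T]`: the sums of `Ξ` over partitions of
`[0, t]` converge to `J t - J 0` as the mesh size tends to zero. -/
def IsIndefiniteIntegral (T : ℝ) (Ξ : ℝ → ℝ → E) (J : ℝ → E) : Prop :=
  ∀ t ∈ Icc 0 T, ∀ ε > 0, ∃ δ > 0, ∀ (n : ℕ) (p : ℕ → ℝ), p 0 = 0 → p n = t →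
    (∀ k < n, p k < p (k + 1) ∧ p (k + 1) - p k < δ) →
      ‖(∑ k ∈ Finset.range n, Ξ (p k) (p (k + 1))) - (J t - J 0)‖ < ε

lemma isIndefiniteIntegral_of_norm_sub_le {T C θ : ℝ} (hθ : 1 < θ) {Ξ : ℝ → ℝ → E} {J : ℝ → E}
    (h : ∀ u v, 0 ≤ u → u ≤ v → v ≤ T → ‖J v - J u - Ξ u v‖ ≤ C * (v - u) ^ θ) :
    IsIndefiniteIntegral T Ξ J := by
  intro t ht ε hε
  -- On a mesh finer than `δ` the local errors add up to at most `C * t * δ ^ (θ - 1)`.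
  obtain ⟨δ, hδ, hδε⟩ : ∃ δ > 0, (|C| * t) * δ ^ (θ - 1) < ε := by
    have h0 : Filter.Tendsto (fun δ : ℝ => (|C| * t) * δ ^ (θ - 1)) (nhdsWithin 0 (Ioi 0))
        (nhds 0) := by
      have : ContinuousAt (fun δ : ℝ => (|C| * t) * δ ^ (θ - 1)) 0 :=
        continuousAt_const.mul (Real.continuousAt_rpow_const _ _ (.inr (by linarith)))
      have h1 := this.tendsto
      rw [Real.zero_rpow (by linarith), mul_zero] at h1
      exact h1.mono_left nhdsWithin_le_nhds
    obtain ⟨δ, h1, h2⟩ := ((h0.eventually_lt_const hε).and self_mem_nhdsWithin).exists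
    exact ⟨δ, h2, h1⟩
  refine ⟨δ, hδ, fun n p hp0 hpn hp => ?_⟩
  have hmono : ∀ k, k ≤ n → 0 ≤ p k ∧ p k ≤ p n := by
    have hm : ∀ i j, i ≤ j → j ≤ n → p i ≤ p j := by
      intro i j hij
      induction j, hij using Nat.le_induction with
      | base => intro _; exact le_rfl
      | succ j _ ih => intro hj; exact (ih (by omega)).trans (hp j (by omega)).1.le
    exact fun k hk => ⟨hp0 ▸ hm 0 k (Nat.zero_le _) hk, hm k n hk le_rfl⟩
  have htel : J t - J 0 = ∑ k ∈ Finset.range n, (J (p (k + 1)) - J (p k)) := by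
    rw [Finset.sum_range_sub (fun k => J (p k)), hpn, hp0]
  have htel' : ∑ k ∈ Finset.range n, (p (k + 1) - p k) = t := by
    rw [Finset.sum_range_sub, hpn, hp0, sub_zero]
  rw [htel, ← Finset.sum_sub_distrib]
  refine lt_of_le_of_lt ((norm_sum_le _ _).trans (Finset.sum_le_sum (g := fun k =>
    |C| * δ ^ (θ - 1) * (p (k + 1) - p k)) fun k hk => ?_)) ?_
  · have hk' := Finset.mem_range.1 hk
    obtain ⟨h1, h2⟩ := hp k hk'
    rw [norm_sub_rev]
    refine (h _ _ (hmono k hk'.le).1 h1.le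
      ((hmono (k + 1) hk').2.trans (hpn ▸ ht.2))).trans ?_
    have h3 : (p (k + 1) - p k) ^ θ = (p (k + 1) - p k) ^ (θ - 1) * (p (k + 1) - p k) := by
      rw [← Real.rpow_add_one (by linarith)]; ring_nf
    have h4 : (p (k + 1) - p k) ^ (θ - 1) ≤ δ ^ (θ - 1) :=
      Real.rpow_le_rpow (by linarith) h2.le (by linarith)
    rw [h3, ← mul_assoc]
    have : 0 ≤ (p (k + 1) - p k) ^ (θ - 1) := Real.rpow_nonneg (by linarith) _
    gcongr
    exact le_abs_self C
  · rw [← Finset.mul_sum, htel']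
    linarith

/-- A function with increments of order greater than one is constant. -/
lemma eq_of_norm_sub_le_rpow {T C θ : ℝ} (hθ : 1 < θ) {D : ℝ → E}
    (h : ∀ u v, 0 ≤ u → u ≤ v → v ≤ T → ‖D v - D u‖ ≤ C * (v - u) ^ θ) {t : ℝ}
    (ht : t ∈ Icc 0 T) : D t = D 0 := by
  have hint : IsIndefiniteIntegral T (fun _ _ => (0 : E)) D :=
    isIndefiniteIntegral_of_norm_sub_le hθ (by simpa using h)
  rw [← sub_eq_zero, ← norm_le_zero_iff]
  refine le_of_forall_pos_lt_add fun ε hε => ?_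
  obtain ⟨δ, hδ, H⟩ := hint t ht ε hε
  rcases ht.1.eq_or_lt with h0 | h0
  · subst h0; simpa using hε
  obtain ⟨n, hn⟩ := exists_nat_gt (t / δ)
  have hn0 : (0 : ℝ) < n := (div_pos h0 hδ).trans hn
  have := H n (fun k => k * (t / n)) (by simp) (by field_simp) fun k _ => by
    have h1 : ((k + 1 : ℕ) : ℝ) * (t / n) - k * (t / n) = t / n := by push_cast; ring
    have h2 : t / n < δ := by rw [div_lt_comm₀ hn0 hδ]; exact hn
    exact ⟨by linarith [div_pos h0 hn0], by simpa only [h1] using h2⟩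
  simpa [norm_sub_rev] using this

/-- The sum of `Ξ` over the partition of `[u, v]` into `2 ^ n` intervals of equal length. -/
noncomputable def dyadicSum (Ξ : ℝ → ℝ → E) (u v : ℝ) (n : ℕ) : E :=
  ∑ k ∈ Finset.range (2 ^ n), Ξ (u + k * ((v - u) / 2 ^ n)) (u + (k + 1 : ℕ) * ((v - u) / 2 ^ n))

lemma sum_range_two_mul {M : Type*} [AddCommMonoid M] (a : ℕ → M) (n : ℕ) :
    ∑ k ∈ Finset.range (2 * n), a k = ∑ k ∈ Finset.range n, (a (2 * k) + a (2 * k + 1)) := by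
  induction n with
  | zero => simp
  | succ n ih => rw [mul_add, mul_one, Finset.sum_range_succ, Finset.sum_range_succ, ih,
      Finset.sum_range_succ, add_assoc]

/-- Halving all intervals of the dyadic partition produces `2 ^ n` additivity defects, each of order
`θ` in `(v - u) / 2 ^ n`. -/
lemma norm_dyadicSum_succ_sub_le {T C θ : ℝ} {Ξ : ℝ → ℝ → E}
    (hΞ : ∀ s m t, 0 ≤ s → s ≤ m → m ≤ t → t ≤ T →
      ‖Ξ s t - Ξ s m - Ξ m t‖ ≤ C * (t - s) ^ θ) {u v : ℝ} (hu : 0 ≤ u) (huv : u ≤ v) (hv : v ≤ T)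
    (n : ℕ) : ‖dyadicSum Ξ u v (n + 1) - dyadicSum Ξ u v n‖ ≤
      C * (v - u) ^ θ * ((2 : ℝ) ^ (1 - θ)) ^ n := by
  set η := (v - u) / 2 ^ n with hη
  have hη0 : 0 ≤ η := div_nonneg (by linarith) (by positivity)
  have hη2 : (v - u) / 2 ^ (n + 1) = η / 2 := by rw [hη, pow_succ]; field_simp
  have htot : (2 : ℝ) ^ n * η = v - u := by rw [hη]; field_simp
  unfold dyadicSum
  rw [pow_succ, mul_comm (2 ^ n) 2, sum_range_two_mul, ← Finset.sum_sub_distrib, hη2, ← hη]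
  have hterm (k : ℕ) (hk : k ∈ Finset.range (2 ^ n)) :
      ‖Ξ (u + (2 * k : ℕ) * (η / 2)) (u + (2 * k + 1 : ℕ) * (η / 2)) +
        Ξ (u + (2 * k + 1 : ℕ) * (η / 2)) (u + (2 * k + 1 + 1 : ℕ) * (η / 2)) -
        Ξ (u + k * η) (u + (k + 1 : ℕ) * η)‖ ≤ C * η ^ θ := by
    have e1 : u + (2 * k : ℕ) * (η / 2) = u + k * η := by push_cast; ring
    have e2 : u + (2 * k + 1 + 1 : ℕ) * (η / 2) = u + (k + 1 : ℕ) * η := by push_cast; ring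
    have hk1 : ((k + 1 : ℕ) : ℝ) ≤ 2 ^ n := by exact_mod_cast Finset.mem_range.1 hk
    have hk2 := mul_le_mul_of_nonneg_right hk1 hη0
    have h1 := hΞ (u + k * η) (u + (2 * k + 1 : ℕ) * (η / 2)) (u + (k + 1 : ℕ) * η)
      (by positivity) (by push_cast; nlinarith) (by push_cast; nlinarith) (by linarith)
    have e3 : u + (k + 1 : ℕ) * η - (u + k * η) = η := by push_cast; ring
    rw [e3] at h1
    rw [e1, e2, norm_sub_rev, sub_add_eq_sub_sub]
    exact h1
  refine (norm_sum_le_of_le _ hterm).trans_eq ?_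
  rw [Finset.sum_const, Finset.card_range, nsmul_eq_mul, hη, Real.div_rpow (by linarith)
    (by positivity)]
  have h2 : (((2 : ℕ) ^ n : ℕ) : ℝ) = (2 : ℝ) ^ n := by push_cast; rfl
  have h3 : ((2 : ℝ) ^ (1 - θ)) ^ n = 2 ^ n / ((2 : ℝ) ^ n) ^ θ := by
    rw [Real.rpow_sub two_pos, Real.rpow_one, div_pow, ← Real.rpow_natCast _ n,
      ← Real.rpow_natCast ((2 : ℝ) ^ θ) n, ← Real.rpow_mul zero_le_two, mul_comm θ,
      Real.rpow_mul zero_le_two]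
  rw [h2, h3]
  ring

/-- Dyadic partitions of `[u, v]`, prolonged by fine partitions of `[0, u]`, identify the
increment of the indefinite integral over `[u, v]`. -/
lemma IsIndefiniteIntegral.tendsto_dyadicSum {T : ℝ} {Ξ : ℝ → ℝ → E} {J : ℝ → E}
    (hJ : IsIndefiniteIntegral T Ξ J) {u v : ℝ} (hu : 0 ≤ u) (huv : u < v) (hv : v ≤ T) :
    Filter.Tendsto (dyadicSum Ξ u v) Filter.atTop (nhds (J v - J u)) := by
  rw [Metric.tendsto_atTop]
  intro ε hε
  obtain ⟨δ₁, hδ₁, H₁⟩ := hJ u ⟨hu, by linarith⟩ (ε / 2) (by positivity)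
  obtain ⟨δ₂, hδ₂, H₂⟩ := hJ v ⟨by linarith, hv⟩ (ε / 2) (by positivity)
  set δ := min δ₁ δ₂ with hδ
  have hδ0 : 0 < δ := lt_min hδ₁ hδ₂
  have hvu : 0 < v - u := sub_pos.2 huv
  obtain ⟨m, q, hq0, hqm, hq⟩ : ∃ (m : ℕ) (q : ℕ → ℝ), q 0 = 0 ∧ q m = u ∧
      ∀ k < m, q k < q (k + 1) ∧ q (k + 1) - q k < δ := by
    rcases hu.eq_or_lt with h0 | h0
    · exact ⟨0, fun _ => 0, rfl, h0, by simp⟩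
    obtain ⟨m, hm⟩ := exists_nat_gt (u / δ)
    have hm0 : (0 : ℝ) < m := (div_pos h0 hδ0).trans hm
    refine ⟨m, fun k => k * (u / m), by simp, by field_simp, fun k _ => ?_⟩
    have h1 : ((k + 1 : ℕ) : ℝ) * (u / m) - k * (u / m) = u / m := by push_cast; ring
    have h2 : u / m < δ := by rw [div_lt_comm₀ hm0 hδ0]; exact hm
    exact ⟨by linarith [div_pos h0 hm0], by simpa only [h1] using h2⟩
  obtain ⟨N, hN⟩ := pow_unbounded_of_one_lt ((v - u) / δ) (one_lt_two (α := ℝ))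
  refine ⟨N, fun n hn => ?_⟩
  have hn2 : (v - u) / 2 ^ n < δ := by
    rw [div_lt_comm₀ (by positivity) hδ0]
    exact hN.trans_le (pow_le_pow_right₀ one_le_two hn)
  set η := (v - u) / 2 ^ n with hη
  have hη0 : 0 < η := by positivity
  let p : ℕ → ℝ := fun k => if k ≤ m then q k else u + (k - m : ℕ) * η
  have hp1 {k : ℕ} (hk : k ≤ m) : p k = q k := if_pos hk
  have hp2 (k : ℕ) : p (m + k) = u + k * η := by
    rcases k.eq_zero_or_pos with rfl | hk
    · simp [hp1, hqm]
    · simp [p, hk.ne']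
  have h1 := H₁ m q hq0 hqm fun k hk =>
    ⟨(hq k hk).1, (hq k hk).2.trans_le (min_le_left _ _)⟩
  have h2 := H₂ (m + 2 ^ n) p (by rw [hp1 (Nat.zero_le _), hq0])
    (by rw [hp2, hη]; push_cast; field_simp; ring) fun k hk => by
      rcases lt_or_ge k m with h | h
      · rw [hp1 h.le, hp1 h]
        exact ⟨(hq k h).1, (hq k h).2.trans_le (min_le_right _ _)⟩
      · obtain ⟨j, rfl⟩ := Nat.exists_eq_add_of_le h
        rw [add_assoc, hp2, hp2]
        push_cast
        exact ⟨by linarith, by have := min_le_right δ₁ δ₂; linarith⟩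
  rw [Finset.sum_range_add, Finset.sum_congr rfl fun k hk => by
    rw [hp1 (Finset.mem_range.1 hk).le, hp1 (Finset.mem_range.1 hk)]] at h2
  have h3 : ∑ k ∈ Finset.range (2 ^ n), Ξ (p (m + k)) (p (m + k + 1)) = dyadicSum Ξ u v n := by
    refine Finset.sum_congr rfl fun k _ => ?_
    rw [add_assoc, hp2, hp2]
  rw [h3] at h2
  rw [dist_eq_norm]
  set S := ∑ k ∈ Finset.range m, Ξ (q k) (q (k + 1))
  calc ‖dyadicSum Ξ u v n - (J v - J u)‖
      = ‖(S + dyadicSum Ξ u v n - (J v - J 0)) - (S - (J u - J 0))‖ := by congr 1; abel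
    _ ≤ _ := norm_sub_le _ _
    _ < ε := by linarith

/-- The local estimate of the sewing lemma: an indefinite integral is close to its germ. -/
theorem IsIndefiniteIntegral.norm_sub_le {T C θ : ℝ} (hθ : 1 < θ) {Ξ : ℝ → ℝ → E} {J : ℝ → E}
    (hJ : IsIndefiniteIntegral T Ξ J)
    (hΞ : ∀ s m t, 0 ≤ s → s ≤ m → m ≤ t → t ≤ T →
      ‖Ξ s t - Ξ s m - Ξ m t‖ ≤ C * (t - s) ^ θ) {u v : ℝ} (hu : 0 ≤ u) (huv : u ≤ v)
    (hv : v ≤ T) : ‖J v - J u - Ξ u v‖ ≤ C / (1 - 2 ^ (1 - θ)) * (v - u) ^ θ := by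
  rcases huv.eq_or_lt with rfl | huv
  · have h := hΞ u u u hu le_rfl le_rfl hv
    have h0 : (0 : ℝ) ^ θ = 0 := Real.zero_rpow (by linarith)
    simp only [sub_self, h0, mul_zero, zero_sub, norm_neg] at h ⊢
    exact h
  have hr : (2 : ℝ) ^ (1 - θ) < 1 := Real.rpow_lt_one_of_one_lt_of_neg one_lt_two (by linarith)
  have h1 := dist_le_of_le_geometric_of_tendsto₀ _ (C * (v - u) ^ θ) hr (fun n => by
    rw [dist_comm, dist_eq_norm]
    exact norm_dyadicSum_succ_sub_le hΞ hu huv.le hv n) (hJ.tendsto_dyadicSum hu huv hv)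
  rw [dist_comm, dist_eq_norm] at h1
  have h0 : dyadicSum Ξ u v 0 = Ξ u v := by simp [dyadicSum]
  rw [h0] at h1
  exact h1.trans_eq (by ring)

end Sewing

/-! ### Contractions -/

section Contract

variable {d : ℕ}

lemma contract_add (y : Vec d →L[ℝ] Mat d) (w w' : Matrix (Fin d) (Fin d) ℝ) :
    contract y (w + w') = contract y w + contract y w' := by
  simp [contract, add_smul, Finset.sum_add_distrib]

lemma contract_sub_left (y y' : Vec d →L[ℝ] Mat d) (w : Matrix (Fin d) (Fin d) ℝ) :
    contract (y - y') w = contract y w - contract y' w := by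
  simp [contract, smul_sub, Finset.sum_sub_distrib]

lemma contract_vecMulVec (y : Vec d →L[ℝ] Mat d) (a b : Vec d) :
    contract y (Matrix.of fun i j => a i * b j) = y a b := by
  have h (v : Vec d) : v = ∑ i, v i • basisVec i := by
    simpa using ((EuclideanSpace.basisFun (Fin d) ℝ).sum_repr v).symm
  conv_rhs => rw [h a, h b]
  simp only [contract, Matrix.of_apply, map_sum, map_smul, sum_apply,
    smul_apply, Finset.smul_sum, smul_smul]
  rw [Finset.sum_comm]
  simp only [mul_comm]

lemma contract_transpose {y : Vec d →L[ℝ] Mat d} (hy : ∀ u v, y u v = y v u)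
    (w : Matrix (Fin d) (Fin d) ℝ) : contract y w.transpose = contract y w := by
  simp only [contract, Matrix.transpose_apply]
  rw [Finset.sum_comm]
  exact Finset.sum_congr rfl fun i _ => Finset.sum_congr rfl fun j _ => by rw [hy]

lemma norm_contract_le (y : Vec d →L[ℝ] Mat d) {w : Matrix (Fin d) (Fin d) ℝ} {c : ℝ}
    (hw : ∀ i j, |w i j| ≤ c) : ‖contract y w‖ ≤ d ^ 2 * (‖y‖ * c) := by
  have h (i j : Fin d) : ‖w i j • y (basisVec i) (basisVec j)‖ ≤ ‖y‖ * c := by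
    rw [norm_smul, Real.norm_eq_abs, mul_comm]
    have h1 := y.le_opNorm₂ (basisVec i) (basisVec j)
    simp only [PiLp.norm_single, norm_one, mul_one] at h1
    exact mul_le_mul h1 (hw i j) (abs_nonneg _) (norm_nonneg y)
  calc ‖contract y w‖ ≤ ∑ _i : Fin d, ∑ _j : Fin d, ‖y‖ * c :=
        norm_sum_le_of_le _ fun i _ => norm_sum_le_of_le _ fun j _ => h i j
    _ = _ := by simp; ring

/-- Against a symmetric form, the second level of a geometric rough path reduces to the square of
the first level. -/
lemma IsGeometricRoughPath.contract_eq {α T : ℝ} {W : ℝ → Vec d}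
    {𝕎 : ℝ → ℝ → Matrix (Fin d) (Fin d) ℝ} (hW : IsGeometricRoughPath α T W 𝕎)
    {y : Vec d →L[ℝ] Mat d} (hy : ∀ u v, y u v = y v u) {s t : ℝ} (hs : s ∈ Icc 0 T)
    (ht : t ∈ Icc 0 T) : contract y (𝕎 s t) = (2⁻¹ : ℝ) • y (W t - W s) (W t - W s) := by
  have h : 𝕎 s t + (𝕎 s t).transpose =
      Matrix.of fun i j => (W t - W s) i * (W t - W s) j := by
    ext i j
    have := hW.sym s hs t ht i j
    simp
    linarith
  rw [← contract_vecMulVec, ← h, contract_add, contract_transpose hy, ← two_smul ℝ, smul_smul]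
  simp

lemma IsRoughPath.contract_chen {α T : ℝ} {W : ℝ → Vec d}
    {𝕎 : ℝ → ℝ → Matrix (Fin d) (Fin d) ℝ} (hW : IsRoughPath α T W 𝕎)
    (y : Vec d →L[ℝ] Mat d) {s u t : ℝ} (hs : s ∈ Icc 0 T) (hu : u ∈ Icc 0 T)
    (ht : t ∈ Icc 0 T) : contract y (𝕎 s t) =
      contract y (𝕎 s u) + contract y (𝕎 u t) + y (W u - W s) (W t - W u) := by
  have h : 𝕎 s t = 𝕎 s u + 𝕎 u t +
      Matrix.of fun i j => (W u - W s) i * (W t - W u) j := by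
    ext i j
    have := hW.chen s hs u hu t ht i j
    simp
    linarith
  rw [h, contract_add, contract_add, contract_vecMulVec]

end Contract

/-! ### Hölder bounds -/

section Holder

lemma exists_nonneg_holder_bound {T β : ℝ} {a : ℝ → ℝ → ℝ}
    (h : ∃ C : ℝ, ∀ s ∈ Icc 0 T, ∀ t ∈ Icc 0 T, a s t ≤ C * |t - s| ^ β) :
    ∃ C : ℝ, 0 ≤ C ∧ ∀ s t, 0 ≤ s → s ≤ t → t ≤ T → a s t ≤ C * (t - s) ^ β := by
  obtain ⟨C, hC⟩ := h
  refine ⟨max C 0, le_max_right _ _, fun s t hs hst ht => ?_⟩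
  have h1 := hC s ⟨hs, hst.trans ht⟩ t ⟨hs.trans hst, ht⟩
  rw [abs_of_nonneg (sub_nonneg.2 hst)] at h1
  exact h1.trans (mul_le_mul_of_nonneg_right (le_max_left _ _)
    (Real.rpow_nonneg (sub_nonneg.2 hst) _))

lemma continuousOn_of_holder {E : Type*} [NormedAddCommGroup E] {T α : ℝ} (hα : 0 < α)
    {X : ℝ → E} (h : ∃ C : ℝ, ∀ s ∈ Icc 0 T, ∀ t ∈ Icc 0 T, ‖X t - X s‖ ≤ C * |t - s| ^ α) :
    ContinuousOn X (Icc 0 T) := by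
  obtain ⟨C, hC⟩ := h
  intro s hs
  rw [ContinuousWithinAt, tendsto_iff_norm_sub_tendsto_zero]
  have h1 : Filter.Tendsto (fun t => C * |t - s| ^ α) (nhdsWithin s (Icc 0 T)) (nhds 0) := by
    have h2 : ContinuousAt (fun t => C * |t - s| ^ α) s :=
      continuousAt_const.mul (ContinuousAt.rpow_const (by fun_prop) (.inr hα.le))
    have h3 := h2.tendsto
    simp only [sub_self, abs_zero, Real.zero_rpow hα.ne', mul_zero] at h3
    exact h3.mono_left nhdsWithin_le_nhds
  refine squeeze_zero' (.of_forall fun _ => norm_nonneg _) ?_ h1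
  filter_upwards [self_mem_nhdsWithin] with t ht using hC s hs t ht

lemma le_mul_sq_rpow {α T τ : ℝ} (hα : 0 < α) (hα2 : α ≤ 1 / 2) (hτ : 0 ≤ τ) (hτT : τ ≤ T) :
    τ ≤ T ^ (1 - 2 * α) * (τ ^ α) ^ 2 := by
  rcases hτ.eq_or_lt with rfl | h
  · simp [Real.zero_rpow hα.ne']
  · have h1 : τ = τ ^ (1 - 2 * α) * (τ ^ α) ^ 2 := by
      rw [← Real.rpow_mul_natCast hτ, ← Real.rpow_add h]
      norm_num [mul_comm]
    have h2 : τ ^ (1 - 2 * α) ≤ T ^ (1 - 2 * α) := Real.rpow_le_rpow hτ hτT (by linarith)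
    calc τ = _ := h1
      _ ≤ _ := by gcongr

lemma sq_rpow_eq {α τ : ℝ} (hτ : 0 ≤ τ) : τ ^ (2 * α) = (τ ^ α) ^ 2 := by
  rw [← Real.rpow_mul_natCast hτ, mul_comm]; norm_cast

lemma cube_rpow_eq {α τ : ℝ} (hτ : 0 ≤ τ) : τ ^ (3 * α) = (τ ^ α) ^ 3 := by
  rw [← Real.rpow_mul_natCast hτ, mul_comm]; norm_cast

end Holder

/-! ### Euler expansions in the flattened coordinates -/

section Expansion

variable {d : ℕ} {σ : Vec d → Mat d} {G : Vec d ≃ Vec d} {K : ℝ}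

/-- The field `Dσ · σ`: the second derivative of `G⁻¹`, read at `G x`. -/
noncomputable def derivCoeff (σ : Vec d → Mat d) (x : Vec d) : Vec d →L[ℝ] Mat d :=
  (fderiv ℝ σ x).comp (σ x)

namespace IsFlattening

lemma norm_coeff_sub_le (hG : IsFlattening σ G K) (x y : Vec d) :
    ‖σ x - σ y‖ ≤ K * ‖x - y‖ :=
  convex_univ.norm_image_sub_le_of_norm_hasFDerivWithin_le (f' := fderiv ℝ σ)
    (fun z _ => (hG.differentiable z).hasFDerivAt.hasFDerivWithinAt)
    (fun z _ => hG.norm_fderiv_le z) (mem_univ y) (mem_univ x)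

lemma norm_sub_le (hG : IsFlattening σ G K) (x y : Vec d) : ‖G x - G y‖ ≤ K * ‖x - y‖ :=
  convex_univ.norm_image_sub_le_of_norm_hasFDerivWithin_le
    (fun z _ => (hG.hasFDerivAt z).hasFDerivWithinAt)
    (fun z _ => hG.norm_inverse_le z) (mem_univ y) (mem_univ x)

lemma norm_symm_sub_le (hG : IsFlattening σ G K) (x y : Vec d) :
    ‖G.symm x - G.symm y‖ ≤ K * ‖x - y‖ :=
  convex_univ.norm_image_sub_le_of_norm_hasFDerivWithin_le
    (fun z _ => (hG.hasFDerivAt_symm z).hasFDerivWithinAt)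
    (fun _ _ => hG.norm_le _) (mem_univ y) (mem_univ x)

lemma hasFDerivAt_coeff_symm (hG : IsFlattening σ G K) (z : Vec d) :
    HasFDerivAt (fun z => σ (G.symm z)) (derivCoeff σ (G.symm z)) z :=
  (hG.differentiable _).hasFDerivAt.comp z (hG.hasFDerivAt_symm z)

lemma derivCoeff_symm (hG : IsFlattening σ G K) (x u v : Vec d) :
    derivCoeff σ x u v = derivCoeff σ x v u := by
  have := second_derivative_symmetric (𝕜 := ℝ) hG.hasFDerivAt_symm
    (hG.hasFDerivAt_coeff_symm (G x)) u v
  simpa using this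

lemma norm_derivCoeff_le (hG : IsFlattening σ G K) (x : Vec d) : ‖derivCoeff σ x‖ ≤ K ^ 2 := by
  refine (ContinuousLinearMap.opNorm_comp_le _ _).trans ?_
  rw [sq]
  exact mul_le_mul (hG.norm_fderiv_le x) (hG.norm_le x) (norm_nonneg _) hG.nonneg

lemma norm_derivCoeff_sub_le (hG : IsFlattening σ G K) (x y : Vec d) :
    ‖derivCoeff σ x - derivCoeff σ y‖ ≤ 2 * K ^ 2 * ‖x - y‖ := by
  have h : derivCoeff σ x - derivCoeff σ y = (fderiv ℝ σ x - fderiv ℝ σ y).comp (σ x) +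
      (fderiv ℝ σ y).comp (σ x - σ y) := by
    ext1 v
    simp [derivCoeff]
  have hK := hG.nonneg
  rw [h]
  have h1 := ContinuousLinearMap.opNorm_comp_le (fderiv ℝ σ x - fderiv ℝ σ y) (σ x)
  have h2 := ContinuousLinearMap.opNorm_comp_le (fderiv ℝ σ y) (σ x - σ y)
  refine (norm_add_le ((fderiv ℝ σ x - fderiv ℝ σ y).comp (σ x)) _).trans
    ((add_le_add h1 h2).trans ?_)
  calc _ ≤ (K * ‖x - y‖) * K + K * (K * ‖x - y‖) := by
        gcongr
        exacts [hG.norm_fderiv_sub_le x y, hG.norm_le x, hG.norm_fderiv_le y,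
          hG.norm_coeff_sub_le x y]
    _ = _ := by ring

/-- Third order expansion of the image under `G⁻¹` of a step `v + w` from `G x`. -/
lemma norm_symm_add_sub_le (hG : IsFlattening σ G K) (x v w : Vec d) :
    ‖G.symm (G x + (v + w)) - x - σ x v - (σ x w + (2⁻¹ : ℝ) • derivCoeff σ x w w)‖ ≤
      2 * K ^ 3 * (‖v‖ + ‖w‖) ^ 3 + K ^ 2 * (‖v‖ * ‖w‖ + ‖v‖ ^ 2) := by
  have hK := hG.nonneg
  have := norm_taylor_two_add_le hG.hasFDerivAt_symm hG.hasFDerivAt_coeff_symm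
    (L := 2 * K ^ 3) (K := K ^ 2) (fun z z' => ?_) (by positivity)
    (fun z => hG.norm_derivCoeff_le _) (G x) w v
  · simpa using this
  · calc _ ≤ 2 * K ^ 2 * ‖G.symm z - G.symm z'‖ := hG.norm_derivCoeff_sub_le _ _
      _ ≤ 2 * K ^ 2 * (K * ‖z - z'‖) := by gcongr; exact hG.norm_symm_sub_le z z'
      _ = _ := by ring

lemma continuous_coeff (hG : IsFlattening σ G K) : Continuous σ := hG.differentiable.continuous

/-- Freezing `σ` at the left end point in the drift costs an error of order `1 + α`. -/
lemma norm_apply_integral_sub_le (hG : IsFlattening σ G K) {f : Vec d → Vec d} {M : ℝ}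
    (hf : Continuous f) (hM : ∀ x, ‖f x‖ ≤ M) {X : ℝ → Vec d} {s t c : ℝ} (hst : s ≤ t)
    (hX : ContinuousOn X (Icc s t)) (hc : ∀ r ∈ Icc s t, ‖X r - X s‖ ≤ c) :
    ‖σ (X s) (∫ r in s..t, (σ (X r)).inverse (f (X r))) - ∫ r in s..t, f (X r)‖ ≤
      K * c * (K * M) * (t - s) := by
  have hK := hG.nonneg
  have h1 : ContinuousOn (fun r => (σ (X r)).inverse (f (X r))) (Icc s t) :=
    (hG.continuous_inverse.comp_continuousOn hX).clm_apply (hf.comp_continuousOn hX)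
  have h2 : ContinuousOn (fun r => f (X r)) (Icc s t) := hf.comp_continuousOn hX
  have h3 : ContinuousOn (fun r => σ (X s) ((σ (X r)).inverse (f (X r)))) (Icc s t) :=
    (σ (X s)).continuous.comp_continuousOn h1
  rw [← ContinuousLinearMap.intervalIntegral_comp_comm _ (h1.intervalIntegrable_of_Icc hst),
    ← intervalIntegral.integral_sub (h3.intervalIntegrable_of_Icc hst)
      (h2.intervalIntegrable_of_Icc hst), ← abs_of_nonneg (sub_nonneg.2 hst)]
  refine intervalIntegral.norm_integral_le_of_norm_le_const fun r hr => ?_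
  rw [uIoc_of_le hst] at hr
  have hr' : r ∈ Icc s t := Ioc_subset_Icc_self hr
  have h4 : σ (X s) ((σ (X r)).inverse (f (X r))) - f (X r) =
      (σ (X s) - σ (X r)) ((σ (X r)).inverse (f (X r))) := by
    rw [sub_apply, hG.apply_inverse]
  rw [h4]
  refine ContinuousLinearMap.le_of_opNorm_le_of_le _ ?_
    (ContinuousLinearMap.le_of_opNorm_le_of_le _ (hG.norm_inverse_le _) (hM _))
  rw [norm_sub_rev]
  refine (hG.norm_coeff_sub_le _ _).trans ?_
  gcongr
  exact hc r hr'

lemma norm_integral_drift_le (hG : IsFlattening σ G K) {f : Vec d → Vec d} {M : ℝ}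
    (hM : ∀ x, ‖f x‖ ≤ M) (X : ℝ → Vec d) {s t : ℝ} (hst : s ≤ t) :
    ‖∫ r in s..t, (σ (X r)).inverse (f (X r))‖ ≤ K * M * (t - s) := by
  rw [← abs_of_nonneg (sub_nonneg.2 hst)]
  exact intervalIntegral.norm_integral_le_of_norm_le_const fun r _ =>
    ContinuousLinearMap.le_of_opNorm_le_of_le _ (hG.norm_inverse_le _) (hM _)

/-- One step of the additive equation in the flattened coordinates, mapped back by `G⁻¹`, is one
step of the second order Euler scheme of the rough equation, up to an error of order `3α`. Both
implications between the two equations rest on this estimate. -/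
theorem exists_norm_euler_step_sub_le (hG : IsFlattening σ G K) {f : Vec d → Vec d}
    (hf : BoundedContinuous f) {α T : ℝ} (hα : 0 < α) (hα2 : α ≤ 1 / 2) (hT : 0 < T)
    {W X : ℝ → Vec d}
    (hW : ∃ C : ℝ, ∀ s ∈ Icc 0 T, ∀ t ∈ Icc 0 T, ‖W t - W s‖ ≤ C * |t - s| ^ α)
    (hX : ∃ C : ℝ, ∀ s ∈ Icc 0 T, ∀ t ∈ Icc 0 T, ‖X t - X s‖ ≤ C * |t - s| ^ α) :
    ∃ C : ℝ, ∀ s t, 0 ≤ s → s ≤ t → t ≤ T →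
      ‖G.symm (G (X s) + ((∫ r in s..t, (σ (X r)).inverse (f (X r))) + (W t - W s))) - X s -
        (∫ r in s..t, f (X r)) - (σ (X s) (W t - W s) +
          (2⁻¹ : ℝ) • derivCoeff σ (X s) (W t - W s) (W t - W s))‖ ≤ C * (t - s) ^ (3 * α) := by
  obtain ⟨hf, M, hM⟩ := hf
  have hXc := continuousOn_of_holder hα hX
  -- With `ρ = (t - s) ^ α`, both `ρ ≤ R` and `t - s ≤ Q * ρ ^ 2` hold, the latter as `2 * α ≤ 1`;
  -- so the drift counts as a second order quantity and every error term is a multiple of `ρ ^ 3`.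
  obtain ⟨Cw, hCw, hW⟩ := exists_nonneg_holder_bound hW
  obtain ⟨Cx, hCx, hX⟩ := exists_nonneg_holder_bound hX
  have hK := hG.nonneg
  have hM0 : 0 ≤ M := (norm_nonneg _).trans (hM 0)
  set R := T ^ α with hR
  set Q := T ^ (1 - 2 * α) with hQ
  have hR0 : 0 ≤ R := by positivity
  have hQ0 : 0 ≤ Q := by positivity
  refine ⟨2 * K ^ 3 * (K * M * Q * R + Cw) ^ 3 +
    K ^ 2 * (K * M * Q * Cw + (K * M * Q) ^ 2 * R) + K * Cx * (K * M) * Q, fun s t hs hst ht => ?_⟩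
  have hτ : 0 ≤ t - s := sub_nonneg.2 hst
  set ρ := (t - s) ^ α with hρ
  have hρ0 : 0 ≤ ρ := Real.rpow_nonneg hτ _
  have hρR : ρ ≤ R := Real.rpow_le_rpow hτ (by linarith) hα.le
  have hτρ : t - s ≤ Q * ρ ^ 2 := le_mul_sq_rpow hα hα2 hτ (by linarith)
  set v := ∫ r in s..t, (σ (X r)).inverse (f (X r)) with hv
  set w := W t - W s with hw
  have hvn : ‖v‖ ≤ K * M * Q * ρ ^ 2 := by
    refine (hG.norm_integral_drift_le hM X hst).trans ?_
    calc _ ≤ K * M * (Q * ρ ^ 2) := by gcongr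
      _ = _ := by ring
  have hvn' : ‖v‖ ≤ K * M * Q * R * ρ := by
    refine hvn.trans ?_
    calc K * M * Q * ρ ^ 2 = K * M * Q * ρ * ρ := by ring
      _ ≤ K * M * Q * R * ρ := by gcongr
  have hwn : ‖w‖ ≤ Cw * ρ := hW s t hs hst ht
  have h1 := hG.norm_symm_add_sub_le (X s) v w
  have h2 := hG.norm_apply_integral_sub_le hf hM (c := Cx * ρ) hst
    (hXc.mono (Icc_subset_Icc hs ht)) fun r hr => (hX s r hs hr.1 (hr.2.trans ht)).trans
      (mul_le_mul_of_nonneg_left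
        (Real.rpow_le_rpow (sub_nonneg.2 hr.1) (by linarith [hr.2]) hα.le) hCx)
  rw [← hv] at h2
  rw [cube_rpow_eq hτ, ← hρ]
  calc _ = ‖(G.symm (G (X s) + (v + w)) - X s - σ (X s) v -
          (σ (X s) w + (2⁻¹ : ℝ) • derivCoeff σ (X s) w w)) +
          (σ (X s) v - ∫ r in s..t, f (X r))‖ := by congr 1; abel
    _ ≤ _ := norm_add_le_of_le h1 h2
    _ ≤ 2 * K ^ 3 * (K * M * Q * R * ρ + Cw * ρ) ^ 3 +
        K ^ 2 * ((K * M * Q * ρ ^ 2) * (Cw * ρ) + (K * M * Q * ρ ^ 2) * (K * M * Q * R * ρ)) +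
        K * (Cx * ρ) * (K * M) * (Q * ρ ^ 2) := by
      rw [sq ‖v‖]
      gcongr
    _ = _ := by ring

/-- The defect of additivity of the germ of the rough integral is of order `3α`. -/
lemma exists_norm_germ_sub_le (hG : IsFlattening σ G K) {α T : ℝ} (hα : 0 < α)
    {W X : ℝ → Vec d} {𝕎 : ℝ → ℝ → Matrix (Fin d) (Fin d) ℝ} (hW : IsRoughPath α T W 𝕎)
    (hX : IsControlled α T W X fun t => σ (X t)) :
    ∃ C : ℝ, ∀ s m t, 0 ≤ s → s ≤ m → m ≤ t → t ≤ T →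
      ‖(σ (X s) (W t - W s) + contract (derivCoeff σ (X s)) (𝕎 s t)) -
        (σ (X s) (W m - W s) + contract (derivCoeff σ (X s)) (𝕎 s m)) -
        (σ (X m) (W t - W m) + contract (derivCoeff σ (X m)) (𝕎 m t))‖ ≤
          C * (t - s) ^ (3 * α) := by
  obtain ⟨Cw, hCw, hWb⟩ := exists_nonneg_holder_bound hW.holder
  obtain ⟨Cx, hCx, hXb⟩ := exists_nonneg_holder_bound hX.holder
  obtain ⟨Cr, hCr, hRb⟩ := exists_nonneg_holder_bound hX.remainder
  obtain ⟨C₂, hC₂⟩ := hW.holder₂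
  have hK := hG.nonneg
  refine ⟨(K * Cx ^ 2 + K * Cr) * Cw + d ^ 2 * (2 * K ^ 2 * Cx * |C₂|),
    fun s m t hs hsm hmt ht => ?_⟩
  have hsI : s ∈ Icc 0 T := ⟨hs, by linarith⟩
  have hmI : m ∈ Icc 0 T := ⟨by linarith, by linarith⟩
  have htI : t ∈ Icc 0 T := ⟨by linarith, ht⟩
  have hτ : 0 ≤ t - s := by linarith
  set ρ := (t - s) ^ α with hρ
  have hρ0 : 0 ≤ ρ := Real.rpow_nonneg hτ _
  have h1 : (m - s) ^ α ≤ ρ := Real.rpow_le_rpow (by linarith) (by linarith) hα.le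
  have h2 : (t - m) ^ α ≤ ρ := Real.rpow_le_rpow (by linarith) (by linarith) hα.le
  have hw : ‖W t - W m‖ ≤ Cw * ρ := (hWb m t hmI.1 hmt ht).trans (by gcongr)
  have hx : ‖X m - X s‖ ≤ Cx * ρ := (hXb s m hs hsm hmI.2).trans (by gcongr)
  have hr : ‖X m - X s - σ (X s) (W m - W s)‖ ≤ Cr * ρ ^ 2 := by
    refine (hRb s m hs hsm hmI.2).trans ?_
    rw [sq_rpow_eq (by linarith)]
    have : 0 ≤ (m - s) ^ α := Real.rpow_nonneg (by linarith) _
    gcongr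
  have h𝕎 (i j) : |𝕎 m t i j| ≤ |C₂| * ρ ^ 2 := by
    refine (hC₂ m hmI t htI i j).trans ?_
    rw [abs_of_nonneg (a := t - m) (by linarith), sq_rpow_eq (by linarith)]
    have : 0 ≤ (t - m) ^ α := Real.rpow_nonneg (by linarith) _
    gcongr
    exact le_abs_self _
  -- The remainder of `σ(X)` as a controlled path.
  have hσ : ‖σ (X m) - σ (X s) - derivCoeff σ (X s) (W m - W s)‖ ≤
      (K * Cx ^ 2 + K * Cr) * ρ ^ 2 := by
    have e1 := norm_taylor_one_le (fun z => (hG.differentiable z).hasFDerivAt)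
      hG.norm_fderiv_sub_le hK (X s) (X m - X s)
    rw [add_sub_cancel] at e1
    have e2 := ContinuousLinearMap.le_of_opNorm_le_of_le (fderiv ℝ σ (X s))
      (hG.norm_fderiv_le _) hr
    calc _ = ‖(σ (X m) - σ (X s) - fderiv ℝ σ (X s) (X m - X s)) +
            fderiv ℝ σ (X s) (X m - X s - σ (X s) (W m - W s))‖ := by
          rw [map_sub _ (X m - X s)]
          congr 1
          simp only [derivCoeff, ContinuousLinearMap.comp_apply]
          abel
      _ ≤ _ := norm_add_le_of_le e1 e2
      _ ≤ K * (Cx * ρ) ^ 2 + K * (Cr * ρ ^ 2) := by gcongr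
      _ = _ := by ring
  have hA := ContinuousLinearMap.le_of_opNorm_le_of_le _ hσ hw
  have hB := norm_contract_le (derivCoeff σ (X m) - derivCoeff σ (X s)) h𝕎
  rw [cube_rpow_eq hτ, ← hρ]
  calc _ = ‖(σ (X m) - σ (X s) - derivCoeff σ (X s) (W m - W s)) (W t - W m) +
          contract (derivCoeff σ (X m) - derivCoeff σ (X s)) (𝕎 m t)‖ := by
        rw [← norm_neg, hW.contract_chen _ hsI hmI htI, contract_sub_left]
        congr 1
        simp only [sub_apply, map_sub]
        abel
    _ ≤ _ := norm_add_le_of_le hA hB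
    _ ≤ (K * Cx ^ 2 + K * Cr) * ρ ^ 2 * (Cw * ρ) +
        d ^ 2 * (2 * K ^ 2 * (Cx * ρ) * (|C₂| * ρ ^ 2)) := by
      gcongr
      exact (hG.norm_derivCoeff_sub_le _ _).trans (by gcongr)
    _ = _ := by ring

end IsFlattening

end Expansion

/-! ### Equivalence of the two equations -/

section Equivalence

variable {d : ℕ} {σ : Vec d → Mat d} {G : Vec d ≃ Vec d} {K : ℝ} {f : Vec d → Vec d}
  {α T : ℝ} {W X : ℝ → Vec d} {𝕎 : ℝ → ℝ → Matrix (Fin d) (Fin d) ℝ} {x : Vec d}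

lemma intervalIntegrable_of_continuousOn_Icc {E : Type*} [NormedAddCommGroup E] {g : ℝ → E}
    (hg : ContinuousOn g (Icc 0 T)) {s t : ℝ} (hs : s ∈ Icc 0 T) (ht : t ∈ Icc 0 T) :
    IntervalIntegrable g volume s t :=
  (hg.mono (by
    rw [uIcc]
    exact Icc_subset_Icc (le_inf hs.1 ht.1) (sup_le hs.2 ht.2))).intervalIntegrable

namespace IsFlattening

lemma continuousOn_drift (hG : IsFlattening σ G K) (hf : Continuous f)
    (hX : ContinuousOn X (Icc 0 T)) :
    ContinuousOn (fun r => (σ (X r)).inverse (f (X r))) (Icc 0 T) :=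
  (hG.continuous_inverse.comp_continuousOn hX).clm_apply (hf.comp_continuousOn hX)

lemma contract_derivCoeff (hG : IsFlattening σ G K) (hW : IsGeometricRoughPath α T W 𝕎)
    (y : Vec d) {s t : ℝ} (hs : 0 ≤ s) (hst : s ≤ t) (ht : t ≤ T) :
    contract (derivCoeff σ y) (𝕎 s t) =
      (2⁻¹ : ℝ) • derivCoeff σ y (W t - W s) (W t - W s) :=
  hW.contract_eq (hG.derivCoeff_symm y) ⟨hs, hst.trans ht⟩ ⟨hs.trans hst, ht⟩

/-- The rough equation says that `X` minus its drift is the indefinite integral of the germ, so by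
sewing `X` follows the Euler scheme up to order `3α`. Hence so does `G ∘ X` with the additive
equation, and the difference of the two sides of the latter is constant. -/
theorem isAdditiveSolution_of_isRDESolution (hG : IsFlattening σ G K) (hf : BoundedContinuous f)
    (hα : 1 / 3 < α) (hα2 : α ≤ 1 / 2) (hT : 0 < T) (hW0 : W 0 = 0)
    (hW : IsGeometricRoughPath α T W 𝕎) (hX : IsRDESolution α T W 𝕎 f σ x X fun t => σ (X t)) :
    IsAdditiveSolution T W (fun z => (σ (G.symm z)).inverse (f (G.symm z))) (G x)
      fun t => G (X t) := by
  have hα0 : 0 < α := by linarith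
  have hXc := continuousOn_of_holder hα0 hX.controlled.holder
  have hGc : Continuous G := continuous_iff_continuousAt.2 fun z => (hG.hasFDerivAt z).continuousAt
  have hX0 : X 0 = x := by
    have h := hX.equation 0 ⟨le_rfl, hT.le⟩
    rw [← sub_eq_zero, ← norm_le_zero_iff]
    refine le_of_forall_pos_lt_add fun ε hε => ?_
    obtain ⟨δ, -, H⟩ := h ε hε
    simpa [norm_sub_rev] using H 0 (fun _ => 0) rfl rfl (by simp)
  have hdr := hG.continuousOn_drift hf.1 hXc
  have hfX : ContinuousOn (fun r => f (X r)) (Icc 0 T) := hf.1.comp_continuousOn hXc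
  have hint : IsIndefiniteIntegral T
      (fun s t => σ (X s) (W t - W s) + contract (derivCoeff σ (X s)) (𝕎 s t))
      (fun t => X t - ∫ r in (0 : ℝ)..t, f (X r)) := by
    intro t ht
    have h := hX.equation t ht
    rw [← hX0] at h
    have e : X t - X 0 - ∫ r in (0 : ℝ)..t, f (X r) = (X t - ∫ r in (0 : ℝ)..t, f (X r)) -
        (X 0 - ∫ r in (0 : ℝ)..0, f (X r)) := by
      rw [intervalIntegral.integral_same]; abel
    rw [e] at h
    exact h
  obtain ⟨C₁, h₁⟩ := hG.exists_norm_germ_sub_le hα0 hW.toIsRoughPath hX.controlled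
  obtain ⟨C₂, h₂⟩ := hG.exists_norm_euler_step_sub_le hf hα0 hα2 hT hW.holder hX.controlled.holder
  have hθ : 1 < 3 * α := by linarith
  refine ⟨hGc.comp_continuousOn hXc, fun t ht => ?_⟩
  have hconst := eq_of_norm_sub_le_rpow (T := T) hθ
    (D := fun t => G (X t) - (∫ r in (0 : ℝ)..t, (σ (X r)).inverse (f (X r))) - W t)
    (C := K * (C₂ + C₁ / (1 - 2 ^ (1 - 3 * α)))) (fun u v hu huv hv => ?_) ht
  · simp only [intervalIntegral.integral_same, hX0, hW0, sub_zero] at hconst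
    simp only [Equiv.symm_apply_apply, ← hconst]
    abel
  · have hu' : u ∈ Icc 0 T := ⟨hu, huv.trans hv⟩
    have hv' : v ∈ Icc 0 T := ⟨hu.trans huv, hv⟩
    have h0 : (0 : ℝ) ∈ Icc 0 T := ⟨le_rfl, hT.le⟩
    have e1 := intervalIntegral.integral_interval_sub_left
      (intervalIntegrable_of_continuousOn_Icc hdr h0 hv')
      (intervalIntegrable_of_continuousOn_Icc hdr h0 hu')
    have e2 := intervalIntegral.integral_interval_sub_left
      (intervalIntegrable_of_continuousOn_Icc hfX h0 hv')
      (intervalIntegrable_of_continuousOn_Icc hfX h0 hu')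
    have hs := hint.norm_sub_le hθ h₁ hu huv hv
    have hx := h₂ u v hu huv hv
    rw [hG.contract_derivCoeff hW _ hu huv hv] at hs
    rw [← e1, ← e2] at hx
    set I := fun t => ∫ r in (0 : ℝ)..t, (σ (X r)).inverse (f (X r))
    set J := fun t => ∫ r in (0 : ℝ)..t, f (X r)
    set y := G.symm (G (X u) + ((I v - I u) + (W v - W u))) with hy
    have hXy : ‖X v - y‖ ≤ (C₂ + C₁ / (1 - 2 ^ (1 - 3 * α))) * (v - u) ^ (3 * α) := by
      rw [norm_sub_rev, add_mul]
      refine (le_of_eq ?_).trans (norm_sub_le_of_le hx hs)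
      congr 1
      abel
    calc _ = ‖G (X v) - G y‖ := by
          rw [hy, Equiv.apply_symm_apply]
          congr 1
          abel
      _ ≤ K * ‖X v - y‖ := hG.norm_sub_le _ _
      _ ≤ _ := by
        rw [mul_assoc]
        exact mul_le_mul_of_nonneg_left hXy hG.nonneg

/-- For a solution of the additive equation, the Euler step computed in the flattened coordinates is
the exact increment, so the germ approximates the increments of `X` minus its drift up to order
`3α > 1`, and its Riemann sums converge. -/
theorem isRDESolution_of_isAdditiveSolution (hG : IsFlattening σ G K) (hf : BoundedContinuous f)
    (hα : 1 / 3 < α) (hα2 : α ≤ 1 / 2) (hT : 0 < T) (hW0 : W 0 = 0)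
    (hW : IsGeometricRoughPath α T W 𝕎)
    (hZ : IsAdditiveSolution T W (fun z => (σ (G.symm z)).inverse (f (G.symm z))) (G x)
      fun t => G (X t)) : IsRDESolution α T W 𝕎 f σ x X fun t => σ (X t) := by
  have hα0 : 0 < α := by linarith
  have hK := hG.nonneg
  obtain ⟨M, hM⟩ := hf.2
  have hM0 : 0 ≤ M := (norm_nonneg _).trans (hM 0)
  have hFc : Continuous G.symm :=
    continuous_iff_continuousAt.2 fun z => (hG.hasFDerivAt_symm z).continuousAt
  have hXc : ContinuousOn X (Icc 0 T) := by
    simpa [Function.comp_def] using hFc.comp_continuousOn hZ.continuousOn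
  have hdr := hG.continuousOn_drift hf.1 hXc
  have hfX : ContinuousOn (fun r => f (X r)) (Icc 0 T) := hf.1.comp_continuousOn hXc
  have h0 : (0 : ℝ) ∈ Icc 0 T := ⟨le_rfl, hT.le⟩
  have heq := hZ.equation
  simp only [Equiv.symm_apply_apply] at heq
  have hX0 : X 0 = x := by
    have := heq 0 h0
    simpa [hW0] using this
  have hinc {s t : ℝ} (hs : s ∈ Icc 0 T) (ht : t ∈ Icc 0 T) :
      G (X t) = G (X s) + ((∫ r in s..t, (σ (X r)).inverse (f (X r))) + (W t - W s)) := by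
    rw [heq t ht, heq s hs, ← intervalIntegral.integral_interval_sub_left
      (intervalIntegrable_of_continuousOn_Icc hdr h0 ht)
      (intervalIntegrable_of_continuousOn_Icc hdr h0 hs)]
    abel
  have hdrift (s t : ℝ) : ‖∫ r in s..t, (σ (X r)).inverse (f (X r))‖ ≤ K * M * |t - s| :=
    intervalIntegral.norm_integral_le_of_norm_le_const fun r _ =>
      ContinuousLinearMap.le_of_opNorm_le_of_le _ (hG.norm_inverse_le _) (hM _)
  obtain ⟨Cw, hCw⟩ := hW.holder
  -- As `2 * α ≤ 1`, the drift is of the order `|t - s| ^ (2 * α)` of the controlled remainder.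
  set R := T ^ α with hR
  set Q := T ^ (1 - 2 * α) with hQ
  have hR0 : 0 ≤ R := by positivity
  have hQ0 : 0 ≤ Q := by positivity
  have hsmall {s t : ℝ} (hs : s ∈ Icc 0 T) (ht : t ∈ Icc 0 T) :
      |t - s| ≤ Q * (|t - s| ^ α) ^ 2 ∧ |t - s| ^ α ≤ R := by
    have h1 : |t - s| ≤ T := abs_sub_le_of_nonneg_of_le ht.1 ht.2 hs.1 hs.2
    exact ⟨le_mul_sq_rpow hα0 hα2 (abs_nonneg _) h1, Real.rpow_le_rpow (abs_nonneg _) h1 hα0.le⟩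
  have hGX {s t : ℝ} (hs : s ∈ Icc 0 T) (ht : t ∈ Icc 0 T) :
      ‖G (X t) - G (X s)‖ ≤ (K * M * Q * R + Cw) * |t - s| ^ α := by
    obtain ⟨h1, h2⟩ := hsmall hs ht
    have hρ0 : 0 ≤ |t - s| ^ α := by positivity
    rw [hinc hs ht, add_sub_cancel_left]
    refine (norm_add_le_of_le (hdrift s t) (hCw s hs t ht)).trans ?_
    rw [add_mul]
    refine add_le_add_left ?_ _
    calc K * M * |t - s| ≤ K * M * (Q * (|t - s| ^ α) ^ 2) := by gcongr
      _ = K * M * Q * (|t - s| ^ α) * (|t - s| ^ α) := by ring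
      _ ≤ _ := by gcongr
  have hXh : ∃ C : ℝ, ∀ s ∈ Icc 0 T, ∀ t ∈ Icc 0 T, ‖X t - X s‖ ≤ C * |t - s| ^ α := by
    refine ⟨K * (K * M * Q * R + Cw), fun s hs t ht => ?_⟩
    have := hG.norm_symm_sub_le (G (X t)) (G (X s))
    simp only [Equiv.symm_apply_apply] at this
    rw [mul_assoc]
    exact this.trans (mul_le_mul_of_nonneg_left (hGX hs ht) hK)
  refine ⟨⟨hXh, ?_, ?_⟩, ?_, fun _ _ => rfl⟩
  · obtain ⟨C, hC⟩ := hXh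
    refine ⟨K * C, fun s hs t ht => (hG.norm_coeff_sub_le _ _).trans ?_⟩
    rw [mul_assoc]
    exact mul_le_mul_of_nonneg_left (hC s hs t ht) hK
  · have hL (z z' : Vec d) : ‖σ (G.symm z) - σ (G.symm z')‖ ≤ K ^ 2 * ‖z - z'‖ := by
      refine (hG.norm_coeff_sub_le _ _).trans ?_
      rw [sq, mul_assoc]
      exact mul_le_mul_of_nonneg_left (hG.norm_symm_sub_le z z') hK
    refine ⟨K ^ 2 * (K * M * Q * R + Cw) ^ 2 + K * (K * M * Q), fun s hs t ht => ?_⟩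
    obtain ⟨h1, -⟩ := hsmall hs ht
    have h2 := norm_taylor_one_le hG.hasFDerivAt_symm hL (by positivity) (G (X s))
      (G (X t) - G (X s))
    simp only [add_sub_cancel, Equiv.symm_apply_apply] at h2
    have h3 := ContinuousLinearMap.le_of_opNorm_le_of_le (σ (X s)) (hG.norm_le _) (hdrift s t)
    rw [sq_rpow_eq (abs_nonneg _)]
    calc _ = ‖(X t - X s - σ (X s) (G (X t) - G (X s))) +
            σ (X s) (∫ r in s..t, (σ (X r)).inverse (f (X r)))‖ := by
          rw [hinc hs ht, add_sub_cancel_left, map_add]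
          congr 1
          abel
      _ ≤ _ := norm_add_le_of_le h2 h3
      _ ≤ K ^ 2 * ((K * M * Q * R + Cw) * |t - s| ^ α) ^ 2 +
          K * (K * M * (Q * (|t - s| ^ α) ^ 2)) := by
        gcongr
        exact hGX hs ht
      _ = _ := by ring
  · obtain ⟨C, hC⟩ := hG.exists_norm_euler_step_sub_le hf hα0 hα2 hT hW.holder hXh
    have hint : IsIndefiniteIntegral T
        (fun s t => σ (X s) (W t - W s) + contract (derivCoeff σ (X s)) (𝕎 s t))
        (fun t => X t - ∫ r in (0 : ℝ)..t, f (X r)) := by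
      refine isIndefiniteIntegral_of_norm_sub_le (θ := 3 * α) (C := C) (by linarith)
        fun u v hu huv hv => ?_
      have hu' : u ∈ Icc 0 T := ⟨hu, huv.trans hv⟩
      have hv' : v ∈ Icc 0 T := ⟨hu.trans huv, hv⟩
      have h := hC u v hu huv hv
      rw [← hinc hu' hv', Equiv.symm_apply_apply, ← hG.contract_derivCoeff hW _ hu huv hv,
        ← intervalIntegral.integral_interval_sub_left
          (intervalIntegrable_of_continuousOn_Icc hfX h0 hv')
          (intervalIntegrable_of_continuousOn_Icc hfX h0 hu')] at h
      refine (le_of_eq ?_).trans h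
      congr 1
      abel
    intro t ht
    have h := hint t ht
    have e : (X t - ∫ r in (0 : ℝ)..t, f (X r)) - (X 0 - ∫ r in (0 : ℝ)..0, f (X r)) =
        X t - x - ∫ r in (0 : ℝ)..t, f (X r) := by
      rw [intervalIntegral.integral_same, hX0]; abel
    simp only [e] at h
    exact h

end IsFlattening

end Equivalence

/-! ### Fractional Brownian motion starts at the origin -/

lemma IsFractionalBrownianMotion.ae_zero_eq {Ω : Type*} [mΩ : MeasurableSpace Ω] {d : ℕ}
    {ℱ : Filtration ℝ≥0 mΩ} {B : ℝ≥0 → Ω → Vec d} {H : ℝ} {P : Measure Ω}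
    (hB : IsFractionalBrownianMotion ℱ B H P) (hH : 0 < H) : ∀ᵐ ω ∂P, B 0 ω = 0 := by
  have := hB.gaussian.isProbabilityMeasure
  have hlaw := hB.gaussian.hasGaussianLaw_eval 0
  have hL : MemLp (B 0) 2 P := hlaw.memLp_two
  have hi (i : Fin d) : ∀ᵐ ω ∂P, B 0 ω i = 0 := by
    have hLi : MemLp (fun ω => B 0 ω i) 2 P := (EuclideanSpace.proj (𝕜 := ℝ) i).comp_memLp' hL
    have hvar : Var[fun ω => B 0 ω i; P] = 0 := by
      rw [← covariance_self hLi.aestronglyMeasurable.aemeasurable, hB.covariance_eq]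
      simp [Real.zero_rpow (by positivity : 2 * H ≠ 0)]
    have hmean : ∫ ω, B 0 ω i ∂P = 0 := by
      have h1 := (EuclideanSpace.proj (𝕜 := ℝ) i).integral_comp_comm (hL.integrable (by norm_num))
      rw [hB.centered 0] at h1
      simpa using h1
    filter_upwards [ae_eq_integral_of_variance_eq_zero hLi hvar] with ω hω
    rw [hω, hmean]
  filter_upwards [ae_all_iff.2 hi] with ω hω
  ext i
  simpa using hω i

end RoughSDE

theorem mainTheorem4 {d : ℕ} (hd : 1 ≤ d)
    (f : RoughSDE.Vec d → RoughSDE.Vec d) (σ : RoughSDE.Vec d → RoughSDE.Mat d)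
    (hF1 : RoughSDE.BoundedContinuous f)
    (hS1 : RoughSDE.BoundedC2 σ)
    (hS2 : RoughSDE.UniformlyElliptic σ)
    (hS3 : RoughSDE.Conservative (fun x => (σ x).inverse)) :
    ∃ G : RoughSDE.Vec d ≃ RoughSDE.Vec d,
      ContDiff ℝ 1 G ∧ ContDiff ℝ 1 G.symm ∧
      (∀ z, HasFDerivAt G (σ z).inverse z) ∧
      RoughSDE.BoundedContinuous (fun z => fderiv ℝ G (G.symm z) (f (G.symm z))) ∧
      ∀ {Ω : Type*} [mΩ : MeasurableSpace Ω] (P : Measure Ω) [IsProbabilityMeasure P]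
        (ℱ : Filtration ℝ≥0 mΩ) (H α T : ℝ) (B : ℝ≥0 → Ω → RoughSDE.Vec d),
        1 / 3 < α → α < H → H ≤ 1 / 2 → 0 < T →
        RoughSDE.IsFractionalBrownianMotion ℱ B H P →
        ∀ᵐ ω ∂P, ∀ 𝔹 : ℝ → ℝ → Matrix (Fin d) (Fin d) ℝ,
          RoughSDE.IsGeometricRoughPath α T (fun t => B t.toNNReal ω) 𝔹 →
          ∀ (x : RoughSDE.Vec d) (X : ℝ → RoughSDE.Vec d),
            RoughSDE.IsRDESolution α T (fun t => B t.toNNReal ω) 𝔹 f σ x X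
                (fun t => σ (X t)) ↔
              RoughSDE.IsAdditiveSolution T (fun t => B t.toNNReal ω)
                (fun z => fderiv ℝ G (G.symm z) (f (G.symm z))) (G x) (fun t => G (X t)) := by
  obtain ⟨G, K, hG⟩ := RoughSDE.exists_isFlattening hS1 hS2 hS3
  have hfd (z : RoughSDE.Vec d) : fderiv ℝ G z = (σ z).inverse := (hG.hasFDerivAt z).fderiv
  have hsymm : Continuous G.symm :=
    continuous_iff_continuousAt.2 fun z => (hG.hasFDerivAt_symm z).continuousAt
  refine ⟨G, contDiff_one_iff_hasFDerivAt.2 ⟨_, hG.continuous_inverse, hG.hasFDerivAt⟩,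
    contDiff_one_iff_hasFDerivAt.2 ⟨_, hG.continuous_coeff.comp hsymm, hG.hasFDerivAt_symm⟩,
    hG.hasFDerivAt, ?_, ?_⟩
  · simp only [hfd]
    obtain ⟨hf, M, hM⟩ := hF1
    exact ⟨(hG.continuous_inverse.comp hsymm).clm_apply (hf.comp hsymm), K * M, fun z =>
      ContinuousLinearMap.le_of_opNorm_le_of_le _ (hG.norm_inverse_le _) (hM _)⟩
  · intro Ω mΩ P _ ℱ H α T B hα hαH hH hT hB
    simp only [hfd]
    filter_upwards [hB.ae_zero_eq (by linarith)] with ω hω 𝔹 h𝔹 x X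
    have hα2 : α ≤ 1 / 2 := by linarith
    have h0 : B (0 : ℝ).toNNReal ω = 0 := by simpa using hω
    exact ⟨hG.isAdditiveSolution_of_isRDESolution hF1 hα hα2 hT h0 h𝔹,
      hG.isRDESolution_of_isAdditiveSolution hF1 hα hα2 hT h0 h𝔹⟩
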